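/- Consider the myopic binary adversarial channel $\mathrm{MBAC}_{p,q}$. To send one of $M$ equiprobable messages with block length $n$, a (possibly stochastic) encoder produces a word $\mathbf X\in\{0,1\}^n$ distributed according to a law depending on the message $i$. An adversary, who knows the code, observes $\mathbf X$ through a memoryless binary symmetric channel $\mathrm{BSC}(q)$ as a word $\mathbf z$, and chooses a state sequence $\mathbf s\in\{0,1\}^n$ according to a distribution $J(\mathbf s\mid\mathbf z)$ on $\{0,1\}^n$; the word $\mathbf X\oplus\mathbf s$ is then sent to the receiver through a memoryless $\mathrm{BSC}(p)$. The decoder maps the received word to $\{0,1,\dots,M\}$, where $0$ declares adversarial interference. There is a decoding error if the output is not $i$, except that the output $0$ is not an error when $\mathbf s\neq\mathbf 0$. For a code and a strategy $J$, let $e(J)$ be the error probability averaged over the messages. The adversary is absent when $\mathbf s=\mathbf 0$ always; denote this strategy by $J_{\mathbf 0}$. A rate $R\ge 0$ is achievable for authentication (respectively, in the no-adversary setting) if there is a sequence of codes with $\lceil 2^{nR}\rceil$ messages and block length $n$ such that $\sup_J e(J)\to 0$ (respectively, $e(J_{\mathbf 0})\to 0$) as $n\to\infty$. The authentication capacity $C_{\mathrm{auth}}$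 and the no-adversary capacity $C$ are the suprema of the corresponding achievable rates. Let $H(p)=-p\log_2 p-(1-p)\log_2(1-p)$, with $H(0)=0$. If $0\le p<q\le 1/2$, then $$C_{\mathrm{auth}}=C=1-H(p).$$ Moreover, this rate can be achieved with deterministic encoders (those with a single codeword for each message): the supremum of the rates that are achievable for authentication with deterministic encoders is also $1-H(p)$, and there is a sequence of codes with deterministic encoders, with $M_n$ messages and block length $n$, such that $\frac1n\log_2 M_n\to 1-H(p)$ and $\sup_J e(J)\to 0$. -/

import Mathlib

open Filter Topology
open scoped BigOperators

noncomputable section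

/-- A discrete memoryless adversarial channel with a myopic adversary: `W x s` is the distribution
of the receiver's symbol given the input `x` and the state `s`, `U x` is the distribution of the
adversary's observation given the input `x`, and `s₀` is the no-adversary state.
Probability distributions on a finite alphabet are points of the standard simplex. -/
structure MyopicChannel (X S Y Z : Type) [Fintype X] [Fintype S] [Fintype Y] [Fintype Z] where
  /-- the channel to the receiver -/
  W : X → S → stdSimplex ℝ Y
  /-- the channel to the adversary -/
  U : X → stdSimplex ℝ Z
  /-- the no-adversary state -/
  s₀ : S

/-- An `(M, n)` authentication code. The encoder is stochastic: `enc i` is the distribution of the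
transmitted word given the message `i`. The decoder returns a message, or `none` to declare
adversarial interference. -/
structure AuthCode (X Y : Type) [Fintype X] [Fintype Y] (M n : ℕ) where
  /-- the stochastic encoder -/
  enc : Fin M → stdSimplex ℝ (Fin n → X)
  /-- the decoder -/
  dec : (Fin n → Y) → Option (Fin M)

/-- The encoder is deterministic: each message has a single codeword, sent with probability one. -/
def AuthCode.IsDeterministic {X Y : Type} [Fintype X] [Fintype Y] {M n : ℕ}
    (c : AuthCode X Y M n) : Prop :=
  ∃ f : Fin M → (Fin n → X), ∀ i, (c.enc i).1 (f i) = 1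

/-- A strategy of the myopic adversary for block length `n`: a distribution `J(𝐬 ∣ 𝐳)` of the state
sequence given the whole observed sequence. -/
abbrev Adversary (S Z : Type) [Fintype S] (n : ℕ) : Type :=
  (Fin n → Z) → stdSimplex ℝ (Fin n → S)

/-- The number `⌈2 ^ (n R)⌉` of messages of a code of rate `R` and block length `n`. -/
def numMessages (R : ℝ) (n : ℕ) : ℕ := ⌈(2 : ℝ) ^ ((n : ℝ) * R)⌉₊

namespace MyopicChannel

variable {X S Y Z : Type} [Fintype X] [Fintype S] [Fintype Y] [Fintype Z]

/-- The product channel `W(𝐲 ∣ 𝐱, 𝐬)`. -/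
def prodW (N : MyopicChannel X S Y Z) {n : ℕ} (x : Fin n → X) (s : Fin n → S) (y : Fin n → Y) : ℝ :=
  ∏ k, (N.W (x k) (s k)).1 (y k)

/-- The product channel `U(𝐳 ∣ 𝐱)`. -/
def prodU (N : MyopicChannel X S Y Z) {n : ℕ} (x : Fin n → X) (z : Fin n → Z) : ℝ :=
  ∏ k, (N.U (x k)).1 (z k)

open Classical in
/-- `W(A ∣ 𝐱, 𝐬)`, the probability that the received word lies in `A`. -/
def probW (N : MyopicChannel X S Y Z) {n : ℕ} (x : Fin n → X) (s : Fin n → S)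
    (A : Set (Fin n → Y)) : ℝ :=
  ∑ y : Fin n → Y, if y ∈ A then N.prodW x s y else 0

/-- The constant no-adversary state sequence. -/
def noState (N : MyopicChannel X S Y Z) (n : ℕ) : Fin n → S := fun _ => N.s₀

/-- The strategy of an absent adversary: always the no-adversary state sequence. -/
def noAdversary [DecidableEq S] (N : MyopicChannel X S Y Z) (n : ℕ) : Adversary S Z n := fun _ =>
  ⟨Pi.single (N.noState n) 1, single_mem_stdSimplex ℝ _⟩

/-- The error probability `e(i, J)` given the message `i`: if the state sequence is the
no-adversary one, every output other than `i` is an error; otherwise every output other than `i`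
and the declaration of interference is. -/
def errorAt [DecidableEq S] (N : MyopicChannel X S Y Z) {M n : ℕ} (c : AuthCode X Y M n)
    (J : Adversary S Z n) (i : Fin M) : ℝ :=
  ∑ x : Fin n → X, (c.enc i).1 x *
    ((∑ z : Fin n → Z, N.prodU x z * (J z).1 (N.noState n) *
        N.probW x (N.noState n) {y | c.dec y ≠ some i}) +
      ∑ s ∈ Finset.univ.erase (N.noState n), ∑ z : Fin n → Z, N.prodU x z * (J z).1 s *
        N.probW x s {y | c.dec y ≠ some i ∧ c.dec y ≠ none})

/-- The average error probability `e(J)` over equiprobable messages. -/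
def avgError [DecidableEq S] (N : MyopicChannel X S Y Z) {M n : ℕ} (c : AuthCode X Y M n)
    (J : Adversary S Z n) : ℝ :=
  (1 / (M : ℝ)) * ∑ i, N.errorAt c J i

/-- `sup_J e(J)`. -/
def worstError [DecidableEq S] (N : MyopicChannel X S Y Z) {M n : ℕ} (c : AuthCode X Y M n) : ℝ :=
  ⨆ J : Adversary S Z n, N.avgError c J

/-- `R` is achievable for authentication, with stochastic encoders allowed. -/
def IsAuthAchievable [DecidableEq S] (N : MyopicChannel X S Y Z) (R : ℝ) : Prop :=
  0 ≤ R ∧ ∃ c : ∀ n, AuthCode X Y (numMessages R n) n,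
    Tendsto (fun n => N.worstError (c n)) atTop (𝓝 0)

/-- `R` is achievable for authentication with deterministic encoders. -/
def IsDetAuthAchievable [DecidableEq S] (N : MyopicChannel X S Y Z) (R : ℝ) : Prop :=
  0 ≤ R ∧ ∃ c : ∀ n, AuthCode X Y (numMessages R n) n, (∀ n, (c n).IsDeterministic) ∧
    Tendsto (fun n => N.worstError (c n)) atTop (𝓝 0)

/-- `R` is achievable when the adversary is absent. -/
def IsNoAdversaryAchievable [DecidableEq S] (N : MyopicChannel X S Y Z) (R : ℝ) : Prop :=
  0 ≤ R ∧ ∃ c : ∀ n, AuthCode X Y (numMessages R n) n,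
    Tendsto (fun n => N.avgError (c n) (N.noAdversary n)) atTop (𝓝 0)

/-- `C` is the authentication capacity: the supremum of all achievable rates. -/
def HasAuthCapacity [DecidableEq S] (N : MyopicChannel X S Y Z) (C : ℝ) : Prop :=
  IsLUB {R | N.IsAuthAchievable R} C

/-- `C` is the authentication capacity when encoders must be deterministic. -/
def HasDetAuthCapacity [DecidableEq S] (N : MyopicChannel X S Y Z) (C : ℝ) : Prop :=
  IsLUB {R | N.IsDetAuthAchievable R} C

/-- `C` is the no-adversary capacity. -/
def HasNoAdversaryCapacity [DecidableEq S] (N : MyopicChannel X S Y Z) (C : ℝ) : Prop :=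
  IsLUB {R | N.IsNoAdversaryAchievable R} C

end MyopicChannel

/-- The transition probabilities of the binary symmetric channel with crossover probability `r`. -/
def bsc (r : unitInterval) (x : ZMod 2) : stdSimplex ℝ (ZMod 2) :=
  ⟨fun y => if y = x then 1 - (r : ℝ) else r, by
    constructor
    · intro y
      dsimp only
      split_ifs
      · exact sub_nonneg.2 r.2.2
      · exact r.2.1
    · have h : ∀ y : ZMod 2, (if y = x then 1 - (r : ℝ) else r) =
          (if y = x then 1 - 2 * (r : ℝ) else 0) + r := by
        intro y
        split_ifs <;> ring
      rw [Finset.sum_congr rfl fun y _ => h y, Finset.sum_add_distrib, Finset.sum_ite_eq']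
      simp [ZMod.card]⟩

/-- The myopic binary adversarial channel with parameters `p` and `q`: the adversary observes `x`
through a BSC(`q`), and `x + s` is sent to the receiver through a BSC(`p`). -/
def mbac (p q : unitInterval) : MyopicChannel (ZMod 2) (ZMod 2) (ZMod 2) (ZMod 2) where
  W x s := bsc p (x + s)
  U x := bsc q x
  s₀ := 0

/-- The binary entropy function, in bits. -/
def binEntropyBits (p : ℝ) : ℝ := Real.binEntropy p / Real.log 2

end

/-! Achievability is random coding at rates `1 - H(q) < R < 1 - H(p)`. The decoder `uniqueDecoder`
returns a message only if its codeword alone is within typical BSC(`p`) noise `A` of the received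
word. Declaring interference is no error when `s ≠ 0`, so the adversary must push the word into the
noise ball of another codeword. But `s` depends on the message only through `z`, and since `R > 1 -
H(q)` exponentially many codewords are compatible with `z`. Since `R < 1 - H(p)`, any fixed total
shift `s + e` carries only an exponentially small fraction of them into a foreign ball. If at most
`K` compatible messages are confusable for each observation and shift, the error is at most two
atypicality tails plus `2 ^ n * u * K / M`, where `u` bounds the probability of a typical BSC(`q`)
noise word (`worstError_uniqueDecoder_le`).

The bound `K` must hold for all `4 ^ n` pairs of observation and shift at once. Confusable pairs
that share a codeword are dependent, so `exists_code` counts matchings: `k` vertex-disjoint pairs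
impose independent constraints, and the expected number of confusable `k`-matchings is at most `μ ^
k / k!`, which beats the union bound once `k ≥ 8 * μ` and `k ≥ 2 * n + 2`. `card_confusable_le`
returns from matchings to messages: the vertices of a maximal matching meet every confusable pair,
and no ball contains more than `D` codewords.

The converse needs only the absent adversary. Decoding regions are disjoint and typical noise words
are individually unlikely, so the success probability is at most a tail plus `2 ^ n * u / M`, which
vanishes for `R > 1 - H(p)`. Authentication lies between deterministic authentication and no
adversary, so all three suprema agree. -/

/-! ### Random codes by counting: matchings of confusable pairs -/

section Combinatorics

variable {ι G : Type*} [DecidableEq ι]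

/-- A finite set of pairwise vertex-disjoint directed edges without loops. -/
def IsPairMatching (S : Finset (ι × ι)) : Prop :=
  Set.InjOn Prod.fst (S : Set (ι × ι)) ∧ Set.InjOn Prod.snd (S : Set (ι × ι)) ∧
    Disjoint (S.image Prod.fst) (S.image Prod.snd)

theorem IsPairMatching.subset {S T : Finset (ι × ι)} (hS : IsPairMatching S) (h : T ⊆ S) :
    IsPairMatching T :=
  ⟨hS.1.mono (Finset.coe_subset.2 h), hS.2.1.mono (Finset.coe_subset.2 h),
    hS.2.2.mono (Finset.image_subset_image h) (Finset.image_subset_image h)⟩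

theorem IsPairMatching.insert {S : Finset (ι × ι)} (hS : IsPairMatching S) {i j : ι} (hij : i ≠ j)
    (hi : i ∉ S.image Prod.fst ∪ S.image Prod.snd) (hj : j ∉ S.image Prod.fst ∪ S.image Prod.snd) :
    IsPairMatching (insert (i, j) S) := by
  obtain ⟨h1, h2, h3⟩ := hS
  simp only [Finset.mem_union, not_or] at hi hj
  have hmem : (i, j) ∉ (S : Set (ι × ι)) := fun h =>
    hi.1 (Finset.mem_image_of_mem Prod.fst (Finset.mem_coe.1 h))
  refine ⟨?_, ?_, ?_⟩
  · rw [Finset.coe_insert, Set.injOn_insert hmem]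
    exact ⟨h1, by simpa using hi.1⟩
  · rw [Finset.coe_insert, Set.injOn_insert hmem]
    exact ⟨h2, by simpa using hj.2⟩
  · rw [Finset.image_insert, Finset.image_insert, Finset.disjoint_insert_left,
      Finset.disjoint_insert_right]
    refine ⟨?_, hj.1, h3⟩
    rw [Finset.mem_insert, not_or]
    exact ⟨hij, hi.2⟩

variable [Fintype ι]

/-- The powers of `N` missing at the constrained sites are moved to the left, which avoids
subtraction in the exponent. -/
theorem prod_ite_mem_mul_pow (F T : Finset ι) (h : Disjoint F T) (l a N : ℕ) :
    (∏ i, if i ∈ F then l else if i ∈ T then a else N) * N ^ (F.card + T.card) =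
      l ^ F.card * a ^ T.card * N ^ Fintype.card ι := by
  have key : ∀ (B : Finset ι) (b : ℕ), ∏ i, (if i ∈ B then b else 1) = b ^ B.card := by
    intro B b
    rw [Finset.prod_ite_mem, Finset.univ_inter, Finset.prod_const]
  have hN : N ^ Fintype.card ι = ∏ _i : ι, N := by simp
  rw [pow_add, ← key F N, ← key T N, ← key F l, ← key T a, hN, ← Finset.prod_mul_distrib,
    ← Finset.prod_mul_distrib, ← Finset.prod_mul_distrib, ← Finset.prod_mul_distrib]
  refine Finset.prod_congr rfl fun i _ => ?_
  by_cases h1 : i ∈ F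
  · have : i ∉ T := Finset.disjoint_left.1 h h1
    simp [h1, this]
  · by_cases h2 : i ∈ T <;> simp [h1, h2]

variable [AddCommGroup G] [DecidableEq G]

open Classical in
/-- A code with few codewords in each translate of `A` and no large matching of confusable pairs
has few messages that are confusable with another one. -/
theorem card_confusable_le {D k : ℕ} {L A : Finset G} {f : ι → G}
    (h1 : ∀ y, (Finset.univ.filter fun i => f i - y ∈ A).card ≤ D) (z s : G)
    (h2 : ∀ S : Finset (ι × ι), IsPairMatching S →
        (∀ e ∈ S, z - f e.1 ∈ L ∧ f e.1 + s - f e.2 ∈ A) → S.card < k) :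
    (Finset.univ.filter fun i => z - f i ∈ L ∧ ∃ j, j ≠ i ∧ f i + s - f j ∈ A).card ≤
      2 * k * (1 + D) := by
  let P : Finset (Finset (ι × ι)) := Finset.univ.filter fun S => IsPairMatching S ∧
    ∀ e ∈ S, z - f e.1 ∈ L ∧ f e.1 + s - f e.2 ∈ A
  have hP : P.Nonempty := ⟨∅, by simp [P, IsPairMatching]⟩
  obtain ⟨S, hSP, hmax⟩ := Finset.exists_max_image P Finset.card hP
  have hSP' : IsPairMatching S ∧ ∀ e ∈ S, z - f e.1 ∈ L ∧ f e.1 + s - f e.2 ∈ A := by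
    simpa [P] using hSP
  obtain ⟨hS, hS'⟩ := hSP'
  set V := S.image Prod.fst ∪ S.image Prod.snd with hV
  have hVc : V.card ≤ 2 * k := by
    have h3 : (S.image Prod.fst).card ≤ S.card := Finset.card_image_le
    have h4 : (S.image Prod.snd).card ≤ S.card := Finset.card_image_le
    have h5 : V.card ≤ _ := Finset.card_union_le (S.image Prod.fst) (S.image Prod.snd)
    have := h2 S hS hS'
    omega
  have hsub : (Finset.univ.filter fun i => z - f i ∈ L ∧ ∃ j, j ≠ i ∧ f i + s - f j ∈ A) ⊆
      V ∪ V.biUnion fun j => Finset.univ.filter fun i => f i - (f j - s) ∈ A := by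
    intro i hi
    obtain ⟨hzi, j, hji, hA⟩ := (Finset.mem_filter.1 hi).2
    by_cases hiV : i ∈ V
    · exact Finset.mem_union_left _ hiV
    · refine Finset.mem_union_right _ (Finset.mem_biUnion.2 ⟨j, ?_, ?_⟩)
      -- If both ends were unmatched, the edge `(i, j)` would enlarge the maximal matching.
      · by_contra hjV
        have hm := hS.insert hji.symm hiV hjV
        have hin : insert (i, j) S ∈ P := by
          simp only [P, Finset.mem_filter, Finset.mem_univ, true_and]
          refine ⟨hm, fun e he => ?_⟩
          rcases Finset.mem_insert.1 he with rfl | he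
          · exact ⟨hzi, hA⟩
          · exact hS' e he
        have hnot : (i, j) ∉ S := fun h =>
          hiV (Finset.mem_union_left _ (Finset.mem_image_of_mem Prod.fst h))
        have := hmax _ hin
        rw [Finset.card_insert_of_notMem hnot] at this
        omega
      · rw [Finset.mem_filter]
        refine ⟨Finset.mem_univ _, ?_⟩
        rwa [show f i - (f j - s) = f i + s - f j by abel]
  calc _ ≤ _ := Finset.card_le_card hsub
    _ ≤ V.card + V.card * D := by
        refine (Finset.card_union_le _ _).trans (Nat.add_le_add_left ?_ _)
        exact Finset.card_biUnion_le_card_mul _ _ _ fun j _ => h1 _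
    _ = V.card * (1 + D) := by ring
    _ ≤ _ := Nat.mul_le_mul_right _ hVc

variable [Fintype G]

-- Vertex-disjoint edges give independent constraints: replacing `f j` by `f i + s - f j` at the
-- head of each edge `(i, j)` is injective, and afterwards each tail ranges over a copy of `L` and
-- each head over `A`.
open Classical in
theorem card_matching_constraint_le {S : Finset (ι × ι)} (hS : IsPairMatching S) (L A : Finset G)
    (z s : G) :
    (Finset.univ.filter fun f : ι → G =>
        ∀ e ∈ S, z - f e.1 ∈ L ∧ f e.1 + s - f e.2 ∈ A).card * Fintype.card G ^ (2 * S.card) ≤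
      (L.card * A.card) ^ S.card * Fintype.card G ^ Fintype.card ι := by
  obtain ⟨h1, h2, h3⟩ := hS
  set F := S.image Prod.fst with hF
  set T := S.image Prod.snd with hT
  have cF : F.card = S.card := Finset.card_image_of_injOn h1
  have cT : T.card = S.card := Finset.card_image_of_injOn h2
  have memF : ∀ {i j}, (i, j) ∈ S → i ∈ F := fun h => Finset.mem_image_of_mem Prod.fst h
  have memT : ∀ {i j}, (i, j) ∈ S → j ∈ T := fun h => Finset.mem_image_of_mem Prod.snd h
  have hne : ∀ {i j}, i ∈ F → (j, i) ∉ S := fun hi h => Finset.disjoint_left.1 h3 hi (memT h)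
  let Φ : (ι → G) → ι → G := fun f i => if h : ∃ j, (j, i) ∈ S then f h.choose + s - f i else f i
  let C : ι → Finset G := fun i =>
    if i ∈ F then L.image (fun v => z - v) else if i ∈ T then A else Finset.univ
  have hle : (Finset.univ.filter fun f : ι → G =>
      ∀ e ∈ S, z - f e.1 ∈ L ∧ f e.1 + s - f e.2 ∈ A).card ≤ (Fintype.piFinset C).card := by
    refine Finset.card_le_card_of_injOn Φ ?_ ?_
    · intro f hf
      have hf' : ∀ e ∈ S, z - f e.1 ∈ L ∧ f e.1 + s - f e.2 ∈ A := by simpa using hf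
      rw [Finset.mem_coe, Fintype.mem_piFinset]
      intro i
      by_cases hi : i ∈ F
      · have hno : ¬ ∃ j, (j, i) ∈ S := fun ⟨j, hj⟩ => hne hi hj
        obtain ⟨e, he, rfl⟩ := Finset.mem_image.1 hi
        simp only [Φ, C, hi, if_true, dif_neg hno]
        exact Finset.mem_image.2 ⟨_, (hf' e he).1, by abel⟩
      · by_cases hi' : i ∈ T
        · have hex : ∃ j, (j, i) ∈ S := by
            obtain ⟨e, he, rfl⟩ := Finset.mem_image.1 hi'
            exact ⟨e.1, he⟩
          simp only [Φ, C, hi, hi', if_true, if_false, dif_pos hex]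
          exact (hf' _ hex.choose_spec).2
        · simp [C, hi, hi']
    -- A tail is never a head, so `Φ` fixes the values at tails; the value at a head is then
    -- recovered by subtraction.
    · intro f _ g _ hfg
      have hF' : ∀ i, (¬ ∃ j, (j, i) ∈ S) → f i = g i := by
        intro i hi
        have := congrFun hfg i
        simpa only [Φ, dif_neg hi] using this
      funext i
      by_cases hi : ∃ j, (j, i) ∈ S
      · have := congrFun hfg i
        simp only [Φ, dif_pos hi] at this
        rw [hF' hi.choose fun ⟨j, hj⟩ => hne (memF hi.choose_spec) hj] at this
        exact sub_right_inj.1 this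
      · exact hF' i hi
  have hC : (Fintype.piFinset C).card ≤
      ∏ i, if i ∈ F then L.card else if i ∈ T then A.card else Fintype.card G := by
    rw [Fintype.card_piFinset]
    refine Finset.prod_le_prod' fun i _ => ?_
    simp only [C]
    split_ifs
    · exact Finset.card_image_le
    · exact le_rfl
    · exact le_rfl
  calc _ ≤ (∏ i, if i ∈ F then L.card else if i ∈ T then A.card else Fintype.card G) *
        Fintype.card G ^ (F.card + T.card) := by
        rw [cF, cT, two_mul]
        exact Nat.mul_le_mul_right _ (hle.trans hC)
    _ = _ := by rw [prod_ite_mem_mul_pow F T h3, cF, cT, mul_pow]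

open Classical in
theorem card_ball_constraint_le (S : Finset ι) (A : Finset G) (y : G) :
    (Finset.univ.filter fun f : ι → G => ∀ i ∈ S, f i - y ∈ A).card * Fintype.card G ^ S.card ≤
      A.card ^ S.card * Fintype.card G ^ Fintype.card ι := by
  let C : ι → Finset G := fun i => if i ∈ S then A.image (fun v => v + y) else Finset.univ
  have hle : (Finset.univ.filter fun f : ι → G => ∀ i ∈ S, f i - y ∈ A) ⊆ Fintype.piFinset C := by
    intro f hf
    have hf' : ∀ i ∈ S, f i - y ∈ A := by simpa using hf
    rw [Fintype.mem_piFinset]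
    intro i
    by_cases hi : i ∈ S
    · simp only [C, hi, if_true]
      exact Finset.mem_image.2 ⟨_, hf' i hi, by abel⟩
    · simp [C, hi]
  have hC : (Fintype.piFinset C).card ≤
      ∏ i, if i ∈ S then A.card else if i ∈ (∅ : Finset ι) then 1 else Fintype.card G := by
    rw [Fintype.card_piFinset]
    refine Finset.prod_le_prod' fun i _ => ?_
    simp only [C]
    split_ifs
    · exact Finset.card_image_le
    · simp_all
    · exact le_rfl
  have := prod_ite_mem_mul_pow S ∅ (Finset.disjoint_empty_right _) A.card 1 (Fintype.card G)
  simp only [Finset.card_empty, add_zero, pow_zero, mul_one] at this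
  rw [← this]
  exact Nat.mul_le_mul_right _ ((Finset.card_le_card hle).trans hC)

open Classical in
/-- Random coding by counting: some code has few codewords in each translate of `A`, and few
disjoint confusable pairs for each observation `z` and each state `s`. -/
theorem exists_code (D k : ℕ) (L A : Finset G)
    (h1 : (Fintype.card G : ℝ) *
      (Fintype.card ι * A.card / Fintype.card G : ℝ) ^ (D + 1) < 1 / 2)
    (h2 : (Fintype.card G : ℝ) ^ 2 *
      ((Fintype.card ι ^ 2 * (L.card * A.card) / Fintype.card G ^ 2 : ℝ) ^ k / k.factorial) < 1 / 2) :
    ∃ f : ι → G, (∀ y, (Finset.univ.filter fun i => f i - y ∈ A).card ≤ D) ∧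
      ∀ (z s : G) (S : Finset (ι × ι)), IsPairMatching S →
        (∀ e ∈ S, z - f e.1 ∈ L ∧ f e.1 + s - f e.2 ∈ A) → S.card < k := by
  by_contra hcon
  push Not at hcon
  set N : ℕ := Fintype.card G with hN
  set M : ℕ := Fintype.card ι with hM
  have hNpos : (0 : ℝ) < N := by
    rw [hN]; exact_mod_cast Fintype.card_pos
  -- `B1` and `B2` contain the codes violating the first and the second requirement. By `h1` and
  -- `h2` each holds less than half of all codes, so together they cannot cover.
  let B1 : Finset (ι → G) := Finset.univ.biUnion fun y : G =>
    (Finset.powersetCard (D + 1) (Finset.univ : Finset ι)).biUnion fun S =>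
      Finset.univ.filter fun f : ι → G => ∀ i ∈ S, f i - y ∈ A
  let B2 : Finset (ι → G) := (Finset.univ : Finset (G × G)).biUnion fun t =>
    ((Finset.powersetCard k (Finset.univ : Finset (ι × ι))).filter IsPairMatching).biUnion fun S =>
      Finset.univ.filter fun f : ι → G => ∀ e ∈ S, t.1 - f e.1 ∈ L ∧ f e.1 + t.2 - f e.2 ∈ A
  have hcover : (Finset.univ : Finset (ι → G)) ⊆ B1 ∪ B2 := by
    intro f _
    rw [Finset.mem_union]
    by_cases hf : ∀ y, (Finset.univ.filter fun i => f i - y ∈ A).card ≤ D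
    · right
      obtain ⟨z, s, S, hS, hS', hk⟩ := hcon f hf
      obtain ⟨S', hS'S, hcard⟩ := Finset.exists_subset_card_eq hk
      simp only [B2, Finset.mem_biUnion, Finset.mem_univ, true_and, Finset.mem_filter,
        Finset.mem_powersetCard, Finset.subset_univ]
      exact ⟨(z, s), S', ⟨hcard, hS.subset hS'S⟩, fun e he => hS' e (hS'S he)⟩
    · left
      push Not at hf
      obtain ⟨y, hy⟩ := hf
      obtain ⟨S', hS'S, hcard⟩ := Finset.exists_subset_card_eq (Nat.succ_le_of_lt hy)
      simp only [B1, Finset.mem_biUnion, Finset.mem_univ, true_and, Finset.mem_filter,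
        Finset.mem_powersetCard, Finset.subset_univ]
      exact ⟨y, S', hcard, fun i hi => (Finset.mem_filter.1 (hS'S hi)).2⟩
  have hB1 : (B1.card : ℝ) ≤ N * (M * A.card / N : ℝ) ^ (D + 1) * N ^ M := by
    have hterm : ∀ y : G, ∀ S ∈ Finset.powersetCard (D + 1) (Finset.univ : Finset ι),
        ((Finset.univ.filter fun f : ι → G => ∀ i ∈ S, f i - y ∈ A).card : ℝ) ≤
          (A.card / N : ℝ) ^ (D + 1) * N ^ M := by
      intro y S hS
      have := card_ball_constraint_le S A y
      rw [(Finset.mem_powersetCard.1 hS).2] at this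
      rw [div_pow, div_mul_eq_mul_div, le_div_iff₀ (by positivity)]
      exact_mod_cast this
    have hS : (B1.card : ℝ) ≤ ∑ _y : G,
        ∑ _S ∈ Finset.powersetCard (D + 1) (Finset.univ : Finset ι),
          (A.card / N : ℝ) ^ (D + 1) * N ^ M := by
      refine (Nat.cast_le.2 Finset.card_biUnion_le).trans ?_
      push_cast
      refine Finset.sum_le_sum fun y _ => ?_
      refine (Nat.cast_le.2 Finset.card_biUnion_le).trans ?_
      push_cast
      exact Finset.sum_le_sum fun S hS => hterm y S hS
    refine hS.trans ?_
    simp only [Finset.sum_const, Finset.card_powersetCard, Finset.card_univ, nsmul_eq_mul]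
    rw [← hN, ← hM, mul_div_assoc, mul_pow]
    have : ((M.choose (D + 1) : ℕ) : ℝ) ≤ (M : ℝ) ^ (D + 1) := by
      exact_mod_cast Nat.choose_le_pow M (D + 1)
    calc (N : ℝ) * ((M.choose (D + 1) : ℕ) * ((A.card / N : ℝ) ^ (D + 1) * N ^ M))
        ≤ N * ((M : ℝ) ^ (D + 1) * ((A.card / N : ℝ) ^ (D + 1) * N ^ M)) := by gcongr
      _ = _ := by ring
  have hB2 : (B2.card : ℝ) ≤
      N ^ 2 * ((M ^ 2 * (L.card * A.card) / N ^ 2 : ℝ) ^ k / k.factorial) * N ^ M := by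
    have hterm : ∀ t : G × G,
        ∀ S ∈ (Finset.powersetCard k (Finset.univ : Finset (ι × ι))).filter IsPairMatching,
        ((Finset.univ.filter fun f : ι → G =>
          ∀ e ∈ S, t.1 - f e.1 ∈ L ∧ f e.1 + t.2 - f e.2 ∈ A).card : ℝ) ≤
          ((L.card * A.card) / N ^ 2 : ℝ) ^ k * N ^ M := by
      intro t S hS
      rw [Finset.mem_filter, Finset.mem_powersetCard] at hS
      have := card_matching_constraint_le hS.2 L A t.1 t.2
      rw [hS.1.2] at this
      rw [div_pow, div_mul_eq_mul_div, le_div_iff₀ (by positivity), ← pow_mul]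
      exact_mod_cast this
    have hS : (B2.card : ℝ) ≤ ∑ _t : G × G,
        ∑ _S ∈ (Finset.powersetCard k (Finset.univ : Finset (ι × ι))).filter IsPairMatching,
          ((L.card * A.card) / N ^ 2 : ℝ) ^ k * N ^ M := by
      refine (Nat.cast_le.2 Finset.card_biUnion_le).trans ?_
      push_cast
      refine Finset.sum_le_sum fun y _ => ?_
      refine (Nat.cast_le.2 Finset.card_biUnion_le).trans ?_
      push_cast
      exact Finset.sum_le_sum fun S hS => hterm y S hS
    refine hS.trans ?_
    simp only [Finset.sum_const, Finset.card_univ, nsmul_eq_mul, Fintype.card_prod]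
    -- Edge sets are unordered; the resulting `k!` is what lets `k` be only a constant multiple of
    -- the mean.
    have hc : ((((Finset.powersetCard k (Finset.univ : Finset (ι × ι))).filter
        IsPairMatching).card : ℕ) : ℝ) ≤ ((M : ℝ) ^ 2) ^ k / k.factorial := by
      refine (Nat.cast_le.2 (Finset.card_filter_le _ _)).trans ?_
      rw [Finset.card_powersetCard, Finset.card_univ, Fintype.card_prod, ← hM, ← sq]
      exact_mod_cast Nat.choose_le_pow_div (α := ℝ) k (M ^ 2)
    rw [← hN]
    push_cast
    calc _ ≤ (N : ℝ) * N * (((M : ℝ) ^ 2) ^ k / k.factorial *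
          ((L.card * A.card / N ^ 2 : ℝ) ^ k * N ^ M)) := by gcongr
      _ = _ := by rw [mul_div_assoc ((M : ℝ) ^ 2), mul_pow]; ring
  have hall : (N : ℝ) ^ M ≤ B1.card + B2.card := by
    have := (Finset.card_le_card hcover).trans (Finset.card_union_le B1 B2)
    rw [Finset.card_univ, Fintype.card_fun] at this
    exact_mod_cast this
  have hNM : (0 : ℝ) < (N : ℝ) ^ M := by positivity
  have := mul_lt_mul_of_pos_right h1 hNM
  have := mul_lt_mul_of_pos_right h2 hNM
  linarith

end Combinatorics

/-! ### Second moments and typical sets for i.i.d. letters -/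

section Typicality

variable {α : Type*} [Fintype α]

theorem sum_fun_succ {n : ℕ} (F : (Fin (n + 1) → α) → ℝ) :
    ∑ e, F e = ∑ a, ∑ e : Fin n → α, F (Fin.cons a e) := by
  rw [← Fintype.sum_prod_type', ← (Fin.consEquiv fun _ : Fin (n + 1) => α).sum_comp]
  rfl

theorem sum_prod_eq_one {w : α → ℝ} (hw : ∑ a, w a = 1) (n : ℕ) :
    ∑ e : Fin n → α, ∏ k, w (e k) = 1 := by
  induction n with
  | zero => simp
  | succ n ih =>
    rw [sum_fun_succ]
    simp only [Fin.prod_univ_succ, Fin.cons_zero, Fin.cons_succ, ← Finset.mul_sum, ih, mul_one, hw]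

theorem sum_prod_mul_sum_eq_zero {w g : α → ℝ} (hw : ∑ a, w a = 1) (hg : ∑ a, w a * g a = 0)
    (n : ℕ) : ∑ e : Fin n → α, (∏ k, w (e k)) * ∑ k, g (e k) = 0 := by
  induction n with
  | zero => simp
  | succ n ih =>
    rw [sum_fun_succ]
    simp only [Fin.prod_univ_succ, Fin.sum_univ_succ, Fin.cons_zero, Fin.cons_succ]
    have : ∀ a, ∑ e : Fin n → α, w a * (∏ k, w (e k)) * (g a + ∑ k, g (e k)) = w a * g a := by
      intro a
      calc _ = w a * g a * ∑ e : Fin n → α, (∏ k, w (e k)) +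
            w a * ∑ e : Fin n → α, (∏ k, w (e k)) * ∑ k, g (e k) := by
            rw [Finset.mul_sum, Finset.mul_sum, ← Finset.sum_add_distrib]
            exact Finset.sum_congr rfl fun e _ => by ring
        _ = _ := by rw [ih, sum_prod_eq_one hw]; ring
    simp only [this, hg]

/-- Since `g` has mean zero, the cross term vanishes at each induction step. -/
theorem sum_prod_mul_sum_sq {w g : α → ℝ} (hw : ∑ a, w a = 1) (hg : ∑ a, w a * g a = 0)
    (n : ℕ) :
    ∑ e : Fin n → α, (∏ k, w (e k)) * (∑ k, g (e k)) ^ 2 = n * ∑ a, w a * g a ^ 2 := by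
  induction n with
  | zero => simp
  | succ n ih =>
    rw [sum_fun_succ]
    simp only [Fin.prod_univ_succ, Fin.sum_univ_succ, Fin.cons_zero, Fin.cons_succ]
    have : ∀ a, ∑ e : Fin n → α, w a * (∏ k, w (e k)) * (g a + ∑ k, g (e k)) ^ 2 =
        w a * g a ^ 2 + w a * (n * ∑ a, w a * g a ^ 2) := by
      intro a
      calc _ = w a * g a ^ 2 * ∑ e : Fin n → α, (∏ k, w (e k)) +
            2 * w a * g a * ∑ e : Fin n → α, (∏ k, w (e k)) * ∑ k, g (e k) +
            w a * ∑ e : Fin n → α, (∏ k, w (e k)) * (∑ k, g (e k)) ^ 2 := by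
            rw [Finset.mul_sum, Finset.mul_sum, Finset.mul_sum, ← Finset.sum_add_distrib,
              ← Finset.sum_add_distrib]
            exact Finset.sum_congr rfl fun e _ => by ring
        _ = _ := by rw [ih, sum_prod_mul_sum_eq_zero hw hg, sum_prod_eq_one hw]; ring
    simp only [this, Finset.sum_add_distrib, ← Finset.sum_mul, hw]
    push_cast
    ring

/-- Chebyshev's inequality for the sum of `g` over independent letters. -/
theorem sum_prod_deviation_le {w g : α → ℝ} (hw0 : ∀ a, 0 ≤ w a) (hw : ∑ a, w a = 1)
    (hg : ∑ a, w a * g a = 0) {n : ℕ} (hn : 0 < n) {δ : ℝ} (hδ : 0 < δ)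
    (B : Finset (Fin n → α)) (hB : ∀ e ∈ B, (∏ k, w (e k)) = 0 ∨ n * δ ≤ |∑ k, g (e k)|) :
    ∑ e ∈ B, ∏ k, w (e k) ≤ (∑ a, w a * g a ^ 2) / δ ^ 2 / n := by
  have hn' : (0 : ℝ) < n := Nat.cast_pos.2 hn
  have hp : ∀ e : Fin n → α, 0 ≤ ∏ k, w (e k) := fun e => Finset.prod_nonneg fun k _ => hw0 _
  have h1 : (∑ e ∈ B, ∏ k, w (e k)) * (n * δ) ^ 2 ≤ n * ∑ a, w a * g a ^ 2 := by
    rw [← sum_prod_mul_sum_sq hw hg, Finset.sum_mul]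
    refine (Finset.sum_le_sum fun e he => ?_).trans
      (Finset.sum_le_univ_sum_of_nonneg fun e => mul_nonneg (hp e) (sq_nonneg _))
    rcases hB e he with h | h
    · simp [h]
    · refine mul_le_mul_of_nonneg_left ?_ (hp e)
      rw [← sq_abs (∑ k, g (e k))]
      gcongr
  rw [div_div, le_div_iff₀ (by positivity)]
  have : (∑ e ∈ B, ∏ k, w (e k)) * (n * δ) ^ 2 = n * ((∑ e ∈ B, ∏ k, w (e k)) * (δ ^ 2 * n)) := by
    ring
  rw [this] at h1
  exact le_of_mul_le_mul_left h1 hn'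

/-- The asymptotic equipartition property. -/
theorem exists_typical_set [DecidableEq α] {w : α → ℝ} (hw0 : ∀ a, 0 ≤ w a) (hw : ∑ a, w a = 1) {δ : ℝ}
    (hδ : 0 < δ) {H : ℝ} (hH : ∑ a, w a * Real.logb 2 (w a) = -H) :
    ∃ C : ℝ, ∀ n : ℕ, 0 < n → ∃ T : Finset (Fin n → α),
      ∑ e ∈ Tᶜ, ∏ k, w (e k) ≤ C / n ∧
      (T.card : ℝ) ≤ (2 : ℝ) ^ (n * (H + δ)) ∧
      ∀ e ∈ T, ∏ k, w (e k) ≤ (2 : ℝ) ^ (-(n * (H - δ))) := by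
  classical
  let g : α → ℝ := fun a => Real.logb 2 (w a) + H
  have hg : ∑ a, w a * g a = 0 := by
    simp only [g, mul_add, Finset.sum_add_distrib, ← Finset.sum_mul, hw, hH]
    ring
  refine ⟨(∑ a, w a * g a ^ 2) / δ ^ 2, fun n hn => ?_⟩
  have hp : ∀ e : Fin n → α, 0 ≤ ∏ k, w (e k) := fun e => Finset.prod_nonneg fun k _ => hw0 _
  -- Null words are excluded because `Real.logb 2 0 = 0`: the logarithm of the product is the sum of
  -- the logarithms only when all factors are nonzero.
  let T : Finset (Fin n → α) := Finset.univ.filter fun e =>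
    (∏ k, w (e k)) ≠ 0 ∧ |∑ k, g (e k)| < n * δ
  have hT : ∀ e ∈ T, (2 : ℝ) ^ (-(n * (H + δ))) ≤ ∏ k, w (e k) ∧
      ∏ k, w (e k) ≤ (2 : ℝ) ^ (-(n * (H - δ))) := by
    intro e he
    obtain ⟨h0, hd⟩ := (Finset.mem_filter.1 he).2
    have hpos : 0 < ∏ k, w (e k) := lt_of_le_of_ne (hp e) (Ne.symm h0)
    have hlog : Real.logb 2 (∏ k, w (e k)) = ∑ k, g (e k) - n * H := by
      rw [Real.logb_prod _ _ fun k _ hk => h0 (Finset.prod_eq_zero (Finset.mem_univ k) hk)]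
      simp [g, Finset.sum_add_distrib]
    rw [abs_lt] at hd
    constructor
    · rw [← Real.le_logb_iff_rpow_le one_lt_two hpos, hlog]
      linarith
    · rw [← Real.logb_le_iff_le_rpow one_lt_two hpos, hlog]
      linarith
  refine ⟨T, ?_, ?_, fun e he => (hT e he).2⟩
  · refine sum_prod_deviation_le hw0 hw hg hn hδ _ fun e he => ?_
    have : ¬ ((∏ k, w (e k)) ≠ 0 ∧ |∑ k, g (e k)| < n * δ) := by simpa [T] using he
    by_cases h0 : (∏ k, w (e k)) = 0
    · exact Or.inl h0
    · exact Or.inr (not_lt.1 fun h => this ⟨h0, h⟩)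
  · have h1 : (T.card : ℝ) * (2 : ℝ) ^ (-(n * (H + δ))) ≤ 1 := by
      rw [← sum_prod_eq_one hw n, ← nsmul_eq_mul]
      exact (Finset.card_nsmul_le_sum _ _ _ fun e he => (hT e he).1).trans
        (Finset.sum_le_univ_sum_of_nonneg hp)
    rwa [Real.rpow_neg zero_le_two, ← div_eq_mul_inv, div_le_one (by positivity)] at h1

end Typicality

/-! ### The binary channels as additive noise -/

section NoiseWord

/-- The probability that the noise of a BSC(`r`) is the word `e`. -/
noncomputable def noiseProb (r : unitInterval) {n : ℕ} (e : Fin n → ZMod 2) : ℝ :=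
  ∏ k, (bsc r 0).1 (e k)

theorem noiseProb_nonneg (r : unitInterval) {n : ℕ} (e : Fin n → ZMod 2) : 0 ≤ noiseProb r e :=
  Finset.prod_nonneg fun _ _ => (bsc r 0).2.1 _

theorem sum_noiseProb (r : unitInterval) (n : ℕ) :
    ∑ e : Fin n → ZMod 2, noiseProb r e = 1 :=
  sum_prod_eq_one (bsc r 0).2.2 n

theorem bsc_apply_sub (r : unitInterval) (x y : ZMod 2) : (bsc r x).1 y = (bsc r 0).1 (y - x) := by
  simp only [bsc, sub_eq_zero]

theorem sum_bsc_mul_logb (r : unitInterval) :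
    ∑ a, (bsc r 0).1 a * Real.logb 2 ((bsc r 0).1 a) = -binEntropyBits r := by
  have : ∀ F : ZMod 2 → ℝ, ∑ a, F a = F 0 + F 1 := fun F => Fin.sum_univ_two F
  rw [this]
  simp only [bsc, binEntropyBits, Real.binEntropy, Real.logb, if_true, one_ne_zero, if_false,
    Real.log_inv]
  ring

theorem exists_typical_noise (r : unitInterval) {δ : ℝ} (hδ : 0 < δ) :
    ∃ C : ℝ, ∀ n : ℕ, 0 < n → ∃ T : Finset (Fin n → ZMod 2),
      ∑ e ∈ Tᶜ, noiseProb r e ≤ C / n ∧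
      (T.card : ℝ) ≤ (2 : ℝ) ^ (n * (binEntropyBits r + δ)) ∧
      ∀ e ∈ T, noiseProb r e ≤ (2 : ℝ) ^ (-(n * (binEntropyBits r - δ))) := by
  obtain ⟨C, hC⟩ := exists_typical_set (bsc r 0).2.1 (bsc r 0).2.2 hδ (sum_bsc_mul_logb r)
  exact ⟨C, fun n hn => hC n hn⟩

theorem mbac_prodU (p q : unitInterval) {n : ℕ} (x z : Fin n → ZMod 2) :
    (mbac p q).prodU x z = noiseProb q (z - x) :=
  Finset.prod_congr rfl fun k _ => bsc_apply_sub q (x k) (z k)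

theorem mbac_prodW (p q : unitInterval) {n : ℕ} (x s y : Fin n → ZMod 2) :
    (mbac p q).prodW x s y = noiseProb p (y - (x + s)) :=
  Finset.prod_congr rfl fun k _ => bsc_apply_sub p (x k + s k) (y k)

theorem mbac_noState (p q : unitInterval) (n : ℕ) : (mbac p q).noState n = 0 := rfl

open Classical in
theorem mbac_probW (p q : unitInterval) {n : ℕ} (x s : Fin n → ZMod 2)
    (A : Set (Fin n → ZMod 2)) :
    (mbac p q).probW x s A = ∑ e, if x + s + e ∈ A then noiseProb p e else 0 := by
  rw [MyopicChannel.probW]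
  refine (Equiv.sum_comp (Equiv.addLeft (x + s)) _).symm.trans ?_
  refine Finset.sum_congr rfl fun e _ => ?_
  simp only [Equiv.coe_addLeft, mbac_prodW, add_sub_cancel_left]

end NoiseWord

/-! ### Error probabilities of a general myopic channel -/

namespace MyopicChannel

variable {X S Y Z : Type} [Fintype X] [Fintype S] [Fintype Y] [Fintype Z]

theorem prodU_nonneg (N : MyopicChannel X S Y Z) {n : ℕ} (x : Fin n → X) (z : Fin n → Z) :
    0 ≤ N.prodU x z :=
  Finset.prod_nonneg fun _ _ => (N.U _).2.1 _

theorem prodW_nonneg (N : MyopicChannel X S Y Z) {n : ℕ} (x : Fin n → X) (s : Fin n → S)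
    (y : Fin n → Y) : 0 ≤ N.prodW x s y :=
  Finset.prod_nonneg fun _ _ => (N.W _ _).2.1 _

theorem sum_prodU (N : MyopicChannel X S Y Z) {n : ℕ} (x : Fin n → X) :
    ∑ z, N.prodU x z = 1 := by
  classical
  unfold prodU
  rw [← Fintype.prod_sum (fun k (b : Z) => (N.U (x k)).1 b)]
  exact Finset.prod_eq_one fun k _ => (N.U (x k)).2.2

theorem sum_prodW (N : MyopicChannel X S Y Z) {n : ℕ} (x : Fin n → X) (s : Fin n → S) :
    ∑ y, N.prodW x s y = 1 := by
  classical
  unfold prodW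
  rw [← Fintype.prod_sum (fun k (b : Y) => (N.W (x k) (s k)).1 b)]
  exact Finset.prod_eq_one fun k _ => (N.W (x k) (s k)).2.2

theorem probW_nonneg (N : MyopicChannel X S Y Z) {n : ℕ} (x : Fin n → X) (s : Fin n → S)
    (A : Set (Fin n → Y)) : 0 ≤ N.probW x s A := by
  refine Finset.sum_nonneg fun y _ => ?_
  split_ifs
  exacts [N.prodW_nonneg x s y, le_rfl]

theorem probW_le_one (N : MyopicChannel X S Y Z) {n : ℕ} (x : Fin n → X) (s : Fin n → S)
    (A : Set (Fin n → Y)) : N.probW x s A ≤ 1 := by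
  rw [← N.sum_prodW x s]
  refine Finset.sum_le_sum fun y _ => ?_
  split_ifs
  exacts [le_rfl, N.prodW_nonneg x s y]

/-- The received words that count as errors when message `i` is sent in state `s`. -/
def errorSet (N : MyopicChannel X S Y Z) {M n : ℕ} (c : AuthCode X Y M n) (i : Fin M)
    (s : Fin n → S) : Set (Fin n → Y) :=
  {y | c.dec y ≠ some i ∧ (s = N.noState n ∨ c.dec y ≠ none)}

variable [DecidableEq S]

/-- Folding both error clauses into `errorSet` leaves a single average over all states, so later
bounds need not separate out `noState`. -/
theorem errorAt_eq (N : MyopicChannel X S Y Z) {M n : ℕ} (c : AuthCode X Y M n)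
    (J : Adversary S Z n) (i : Fin M) :
    N.errorAt c J i = ∑ x, (c.enc i).1 x *
      ∑ z, N.prodU x z * ∑ s, (J z).1 s * N.probW x s (N.errorSet c i s) := by
  unfold errorAt
  refine Finset.sum_congr rfl fun x _ => ?_
  congr 1
  simp only [Finset.mul_sum, ← mul_assoc]
  symm
  rw [Finset.sum_comm, ← Finset.add_sum_erase _ _ (Finset.mem_univ (N.noState n))]
  congr 1
  · refine Finset.sum_congr rfl fun z _ => ?_
    simp [errorSet]
  · refine Finset.sum_congr rfl fun s hs => Finset.sum_congr rfl fun z _ => ?_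
    have : s ≠ N.noState n := Finset.ne_of_mem_erase hs
    simp [errorSet, this]

theorem errorAt_nonneg (N : MyopicChannel X S Y Z) {M n : ℕ} (c : AuthCode X Y M n)
    (J : Adversary S Z n) (i : Fin M) : 0 ≤ N.errorAt c J i := by
  rw [errorAt_eq]
  exact Finset.sum_nonneg fun x _ => mul_nonneg ((c.enc i).2.1 x) <|
    Finset.sum_nonneg fun z _ => mul_nonneg (N.prodU_nonneg x z) <|
      Finset.sum_nonneg fun s _ => mul_nonneg ((J z).2.1 s) (N.probW_nonneg x s _)

theorem errorAt_le_one (N : MyopicChannel X S Y Z) {M n : ℕ} (c : AuthCode X Y M n)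
    (J : Adversary S Z n) (i : Fin M) : N.errorAt c J i ≤ 1 := by
  rw [errorAt_eq, ← (c.enc i).2.2]
  refine Finset.sum_le_sum fun x _ => mul_le_of_le_one_right ((c.enc i).2.1 x) ?_
  rw [← N.sum_prodU x]
  refine Finset.sum_le_sum fun z _ => mul_le_of_le_one_right (N.prodU_nonneg x z) ?_
  rw [← (J z).2.2]
  exact Finset.sum_le_sum fun s _ => mul_le_of_le_one_right ((J z).2.1 s) (N.probW_le_one x s _)

theorem avgError_nonneg (N : MyopicChannel X S Y Z) {M n : ℕ} (c : AuthCode X Y M n)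
    (J : Adversary S Z n) : 0 ≤ N.avgError c J :=
  mul_nonneg (by positivity) (Finset.sum_nonneg fun i _ => N.errorAt_nonneg c J i)

theorem avgError_le_one (N : MyopicChannel X S Y Z) {M n : ℕ} (c : AuthCode X Y M n)
    (J : Adversary S Z n) : N.avgError c J ≤ 1 := by
  have : ∑ i, N.errorAt c J i ≤ M := by
    simpa using Finset.sum_le_sum fun i (_ : i ∈ Finset.univ) => N.errorAt_le_one c J i
  rw [avgError, one_div_mul_eq_div]
  exact div_le_one_of_le₀ this (Nat.cast_nonneg _)

theorem avgError_le_worstError (N : MyopicChannel X S Y Z) {M n : ℕ} (c : AuthCode X Y M n)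
    (J : Adversary S Z n) : N.avgError c J ≤ N.worstError c :=
  le_ciSup (f := fun J => N.avgError c J)
    ⟨1, by rintro _ ⟨J, rfl⟩; exact N.avgError_le_one c J⟩ J

theorem worstError_nonneg (N : MyopicChannel X S Y Z) {M n : ℕ} (c : AuthCode X Y M n) :
    0 ≤ N.worstError c :=
  Real.iSup_nonneg fun J => N.avgError_nonneg c J

theorem IsDetAuthAchievable.isAuthAchievable {N : MyopicChannel X S Y Z} {R : ℝ}
    (h : N.IsDetAuthAchievable R) : N.IsAuthAchievable R :=
  let ⟨hR, c, _, hc⟩ := h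
  ⟨hR, c, hc⟩

theorem IsAuthAchievable.isNoAdversaryAchievable {N : MyopicChannel X S Y Z} {R : ℝ}
    (h : N.IsAuthAchievable R) : N.IsNoAdversaryAchievable R :=
  let ⟨hR, c, hc⟩ := h
  ⟨hR, c, squeeze_zero (fun n => N.avgError_nonneg (c n) _)
    (fun n => N.avgError_le_worstError (c n) _) hc⟩

theorem errorAt_noAdversary (N : MyopicChannel X S Y Z) {M n : ℕ} (c : AuthCode X Y M n)
    (i : Fin M) : N.errorAt c (N.noAdversary n) i =
      ∑ x, (c.enc i).1 x * N.probW x (N.noState n) {y | c.dec y ≠ some i} := by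
  rw [errorAt_eq]
  refine Finset.sum_congr rfl fun x _ => ?_
  have : ∀ z : Fin n → Z, ∑ s, (N.noAdversary n z).1 s * N.probW x s (N.errorSet c i s) =
      N.probW x (N.noState n) {y | c.dec y ≠ some i} := by
    intro z
    rw [Fintype.sum_eq_single (N.noState n) fun s hs => by simp [noAdversary, hs]]
    simp [noAdversary, errorSet]
  simp only [this, ← Finset.sum_mul, sum_prodU, one_mul]

end MyopicChannel

/-! ### Deterministic codes and the unique decoder -/

/-- The code with codewords `f` and decoder `d`. -/
noncomputable def AuthCode.ofCodewords {X Y : Type} [Fintype X] [Fintype Y] {M n : ℕ}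
    (f : Fin M → Fin n → X) (d : (Fin n → Y) → Option (Fin M)) : AuthCode X Y M n where
  enc i := by
    classical
    exact ⟨Pi.single (f i) 1, single_mem_stdSimplex ℝ _⟩
  dec := d

theorem AuthCode.isDeterministic_ofCodewords {X Y : Type} [Fintype X] [Fintype Y] {M n : ℕ}
    (f : Fin M → Fin n → X) (d : (Fin n → Y) → Option (Fin M)) :
    (AuthCode.ofCodewords f d).IsDeterministic :=
  ⟨f, fun i => by simp [AuthCode.ofCodewords]⟩

theorem AuthCode.sum_enc_ofCodewords {X Y : Type} [Fintype X] [Fintype Y] {M n : ℕ}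
    (f : Fin M → Fin n → X) (d : (Fin n → Y) → Option (Fin M)) (i : Fin M)
    (F : (Fin n → X) → ℝ) :
    ∑ x, ((AuthCode.ofCodewords f d).enc i).1 x * F x = F (f i) := by
  classical
  rw [Fintype.sum_eq_single (f i) fun x hx => by simp [AuthCode.ofCodewords, hx]]
  simp [AuthCode.ofCodewords]

open Classical in
/-- The decoder that returns the only message whose codeword differs from the received word by a
word of `A`, if there is exactly one. -/
noncomputable def uniqueDecoder {G ι : Type*} [AddGroup G] (f : ι → G) (A : Finset G) (y : G) :
    Option ι :=
  if h : ∃! j, y - f j ∈ A then some h.choose else none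

theorem exists_ne_of_uniqueDecoder_ne_some {G ι : Type*} [AddGroup G] {f : ι → G} {A : Finset G}
    {y : G} {i : ι} (h : uniqueDecoder f A y ≠ some i)
    (h' : y - f i ∈ A ∨ uniqueDecoder f A y ≠ none) : ∃ j, j ≠ i ∧ y - f j ∈ A := by
  by_cases hu : ∃! j, y - f j ∈ A
  · rw [uniqueDecoder, dif_pos hu] at h
    exact ⟨hu.choose, fun hi => h (congrArg some hi), hu.choose_spec.1⟩
  · have h1 : y - f i ∈ A := h'.resolve_right fun hn => hn (dif_neg hu)
    by_contra hcon
    push Not at hcon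
    exact hu ⟨i, h1, fun j hj => by_contra fun hji => hcon j hji hj⟩

/-! ### Error bounds for the binary channel: achievability and converse -/

section Mbac

open MyopicChannel

variable (p q : unitInterval) {M n : ℕ}

-- If `s = 0` and `e ∈ A`, the true codeword passes the test, so an error needs a second one that
-- passes. If `s ≠ 0`, an error is a wrong message, whose codeword passes whatever `e` is.
open Classical in
theorem probW_errorSet_uniqueDecoder_le (f : Fin M → Fin n → ZMod 2)
    (A : Finset (Fin n → ZMod 2)) (i : Fin M) (s : Fin n → ZMod 2) :
    (mbac p q).probW (f i) s
      ((mbac p q).errorSet (AuthCode.ofCodewords f (uniqueDecoder f A)) i s) ≤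
      ∑ e ∈ Aᶜ, noiseProb p e +
        ∑ e, noiseProb p e * if ∃ j, j ≠ i ∧ f i + (s + e) - f j ∈ A then 1 else 0 := by
  have h : ∑ e ∈ Aᶜ, noiseProb p e = ∑ e, if e ∈ A then 0 else noiseProb p e := by
    rw [Finset.sum_ite, Finset.sum_const_zero, zero_add]
    congr 1
    ext e
    simp
  rw [mbac_probW, h, ← Finset.sum_add_distrib]
  refine Finset.sum_le_sum fun e _ => ?_
  have h0 := noiseProb_nonneg p e
  by_cases hB : ∃ j, j ≠ i ∧ f i + (s + e) - f j ∈ A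
  · rw [if_pos hB, mul_one]
    split_ifs <;> linarith
  · rw [if_neg hB, mul_zero, add_zero]
    by_cases hE : f i + s + e ∈
        (mbac p q).errorSet (AuthCode.ofCodewords f (uniqueDecoder f A)) i s
    · obtain ⟨h1, h2⟩ := hE
      have hA : e ∉ A := by
        intro hA
        apply hB
        obtain ⟨j, hj, hj'⟩ := exists_ne_of_uniqueDecoder_ne_some h1 <| h2.imp (fun hs => by
          rw [hs, mbac_noState]; simpa using hA) id
        exact ⟨j, hj, by rwa [← add_assoc]⟩
      rw [if_neg hA]
      split_ifs <;> linarith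
    · rw [if_neg hE]
      split_ifs <;> linarith

-- Myopia enters here: for fixed `z` the law of `s` is the same for all messages. Each compatible
-- message yields `z` with probability at most `u`, so `z` contributes at most `u * K` to the sum
-- over messages, and there are `2 ^ n` observations.
open Classical in
theorem worstError_uniqueDecoder_le (f : Fin M → Fin n → ZMod 2) (hM : 0 < M)
    (A L : Finset (Fin n → ZMod 2)) {u K : ℝ} (hu0 : 0 ≤ u) (hu : ∀ e ∈ L, noiseProb q e ≤ u)
    (hK : ∀ z s, ((Finset.univ.filter fun i =>
      z - f i ∈ L ∧ ∃ j, j ≠ i ∧ f i + s - f j ∈ A).card : ℝ) ≤ K) :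
    (mbac p q).worstError (AuthCode.ofCodewords f (uniqueDecoder f A)) ≤
      ∑ e ∈ Aᶜ, noiseProb p e + ∑ e ∈ Lᶜ, noiseProb q e + 2 ^ n * (u * K / M) := by
  have hM' : (0 : ℝ) < M := Nat.cast_pos.2 hM
  have hK0 : 0 ≤ K := (Nat.cast_nonneg _).trans (hK 0 0)
  have hA0 : 0 ≤ ∑ e ∈ Aᶜ, noiseProb p e := Finset.sum_nonneg fun e _ => noiseProb_nonneg p e
  have hL0 : 0 ≤ ∑ e ∈ Lᶜ, noiseProb q e := Finset.sum_nonneg fun e _ => noiseProb_nonneg q e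
  refine Real.iSup_le (fun J => ?_) (by positivity)
  set tA := ∑ e ∈ Aᶜ, noiseProb p e with htA
  set tL := ∑ e ∈ Lᶜ, noiseProb q e with htL
  let B : Fin M → (Fin n → ZMod 2) → ℝ := fun i t =>
    if ∃ j, j ≠ i ∧ f i + t - f j ∈ A then 1 else 0
  have hB0 : ∀ i t, 0 ≤ B i t := fun i t => by simp only [B]; split_ifs <;> norm_num
  have hB1 : ∀ i t, B i t ≤ 1 := fun i t => by simp only [B]; split_ifs <;> norm_num
  -- Channel noise is counted as part of the shift. As `hK` holds for every shift, averaging over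
  -- `s` and `e` preserves it.
  let Q : Fin M → (Fin n → ZMod 2) → ℝ := fun i z => ∑ s, (J z).1 s * ∑ e, noiseProb p e * B i (s + e)
  have hQ0 : ∀ i z, 0 ≤ Q i z := fun i z => Finset.sum_nonneg fun s _ =>
    mul_nonneg ((J z).2.1 s) <| Finset.sum_nonneg fun e _ =>
      mul_nonneg (noiseProb_nonneg p e) (hB0 i _)
  have hQ1 : ∀ i z, Q i z ≤ 1 := by
    intro i z
    rw [← (J z).2.2]
    refine Finset.sum_le_sum fun s _ => mul_le_of_le_one_right ((J z).2.1 s) ?_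
    rw [← sum_noiseProb p n]
    exact Finset.sum_le_sum fun e _ => mul_le_of_le_one_right (noiseProb_nonneg p e) (hB1 i _)
  have herr : ∀ i, (mbac p q).errorAt (AuthCode.ofCodewords f (uniqueDecoder f A)) J i ≤
      tA + (tL + ∑ z, u * if z - f i ∈ L then Q i z else 0) := by
    intro i
    rw [errorAt_eq, AuthCode.sum_enc_ofCodewords]
    have hs : ∀ z, ∑ s, (J z).1 s * (mbac p q).probW (f i) s
        ((mbac p q).errorSet (AuthCode.ofCodewords f (uniqueDecoder f A)) i s) ≤ tA + Q i z := by
      intro z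
      calc _ ≤ ∑ s, (J z).1 s * (tA + ∑ e, noiseProb p e * B i (s + e)) :=
            Finset.sum_le_sum fun s _ => mul_le_mul_of_nonneg_left
              (probW_errorSet_uniqueDecoder_le p q f A i s) ((J z).2.1 s)
        _ = (∑ s, (J z).1 s) * tA + Q i z := by
            simp only [mul_add, Finset.sum_add_distrib, Finset.sum_mul, Q]
        _ = _ := by
            have : ∑ s, (J z).1 s = 1 := (J z).2.2
            rw [this, one_mul]
    have htL' : tL = ∑ z, if z - f i ∈ L then 0 else noiseProb q (z - f i) := by
      refine Eq.trans ?_ (Equiv.sum_comp (Equiv.subRight (f i))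
        fun e => if e ∈ L then 0 else noiseProb q e).symm
      rw [Finset.sum_ite, Finset.sum_const_zero, zero_add, htL]
      congr 1
      ext e
      simp
    calc _ ≤ ∑ z, (mbac p q).prodU (f i) z * (tA + Q i z) :=
          Finset.sum_le_sum fun z _ =>
            mul_le_mul_of_nonneg_left (hs z) ((mbac p q).prodU_nonneg _ _)
      _ = tA + ∑ z, (mbac p q).prodU (f i) z * Q i z := by
          simp only [mul_add, Finset.sum_add_distrib, ← Finset.sum_mul, sum_prodU, one_mul]
      _ ≤ _ := by
          rw [htL', ← Finset.sum_add_distrib]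
          refine add_le_add le_rfl (Finset.sum_le_sum fun z _ => ?_)
          rw [mbac_prodU]
          by_cases hz : z - f i ∈ L
          · simp only [hz, if_true, zero_add]
            exact mul_le_mul_of_nonneg_right (hu _ hz) (hQ0 i z)
          · simp only [hz, if_false, mul_zero, add_zero]
            exact mul_le_of_le_one_right (noiseProb_nonneg q _) (hQ1 i z)
  have hsum : ∀ z, ∑ i, (if z - f i ∈ L then Q i z else 0) ≤ K := by
    intro z
    have h1 : ∀ i, (if z - f i ∈ L then Q i z else 0) = ∑ s, (J z).1 s * ∑ e, noiseProb p e *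
        (if z - f i ∈ L ∧ ∃ j, j ≠ i ∧ f i + (s + e) - f j ∈ A then 1 else 0) := by
      intro i
      by_cases hz : z - f i ∈ L
      · simp only [hz, if_true, true_and, Q, B]
      · simp [hz]
    simp only [h1]
    rw [Finset.sum_comm]
    have h2 : ∀ s, ∑ i, (J z).1 s * ∑ e, noiseProb p e *
        (if z - f i ∈ L ∧ ∃ j, j ≠ i ∧ f i + (s + e) - f j ∈ A then (1 : ℝ) else 0) ≤
        (J z).1 s * K := by
      intro s
      rw [← Finset.mul_sum]
      refine mul_le_mul_of_nonneg_left ?_ ((J z).2.1 s)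
      rw [Finset.sum_comm]
      calc _ ≤ ∑ e, noiseProb p e * K := by
            refine Finset.sum_le_sum fun e _ => ?_
            rw [← Finset.mul_sum, Finset.sum_boole]
            exact mul_le_mul_of_nonneg_left (hK z (s + e)) (noiseProb_nonneg p e)
        _ = K := by rw [← Finset.sum_mul, sum_noiseProb, one_mul]
    refine (Finset.sum_le_sum fun s _ => h2 s).trans ?_
    have : ∑ s, (J z).1 s = 1 := (J z).2.2
    rw [← Finset.sum_mul, this, one_mul]
  have htot : ∑ i, (mbac p q).errorAt (AuthCode.ofCodewords f (uniqueDecoder f A)) J i ≤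
      M * tA + M * tL + 2 ^ n * (u * K) := by
    calc _ ≤ ∑ i : Fin M, (tA + (tL + ∑ z, u * if z - f i ∈ L then Q i z else 0)) :=
          Finset.sum_le_sum fun i _ => herr i
      _ = M * tA + M * tL + ∑ z, u * ∑ i, (if z - f i ∈ L then Q i z else 0) := by
          have hswap : ∑ i, ∑ z, u * (if z - f i ∈ L then Q i z else 0) =
              ∑ z, u * ∑ i, (if z - f i ∈ L then Q i z else 0) := by
            rw [Finset.sum_comm]
            exact Finset.sum_congr rfl fun z _ => (Finset.mul_sum _ _ _).symm
          rw [Finset.sum_add_distrib, Finset.sum_add_distrib, hswap, add_assoc]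
          simp only [Finset.sum_const, Finset.card_univ, Fintype.card_fin, nsmul_eq_mul]
      _ ≤ M * tA + M * tL + ∑ _z : Fin n → ZMod 2, u * K := by
          gcongr with z
          exact hsum z
      _ = _ := by simp [ZMod.card]
  rw [avgError, one_div_mul_eq_div, div_le_iff₀ hM']
  refine htot.trans (le_of_eq ?_)
  field_simp

-- For each input, typical noise lands in the decoding region of `i` with probability at most `u`
-- times its size, and the disjoint regions have total size at most `2 ^ n`. The bound is uniform in
-- the input, so stochastic encoders gain nothing.
open Classical in
theorem one_sub_avgError_noAdversary_le (hM : 0 < M) (c : AuthCode (ZMod 2) (ZMod 2) M n)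
    (T : Finset (Fin n → ZMod 2)) {u : ℝ} (hu0 : 0 ≤ u) (hu : ∀ e ∈ T, noiseProb p e ≤ u) :
    1 - (mbac p q).avgError c ((mbac p q).noAdversary n) ≤
      ∑ e ∈ Tᶜ, noiseProb p e + 2 ^ n * u / M := by
  have hM' : (0 : ℝ) < M := Nat.cast_pos.2 hM
  set tail := ∑ e ∈ Tᶜ, noiseProb p e with htail
  let D : Fin M → ℝ := fun i => ((Finset.univ.filter fun y => c.dec y = some i).card : ℝ)
  have htail' : tail = ∑ e, if e ∈ T then 0 else noiseProb p e := by
    rw [Finset.sum_ite, Finset.sum_const_zero, zero_add, htail]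
    congr 1
    ext e
    simp
  have h1 : ∀ i x, 1 - (mbac p q).probW x 0 {y | c.dec y ≠ some i} ≤ tail + u * D i := by
    intro i x
    have hD : D i = ∑ e, if c.dec (x + 0 + e) = some i then (1 : ℝ) else 0 := by
      refine Eq.trans ?_ (Equiv.sum_comp (Equiv.addLeft (x + 0))
        fun y => if c.dec y = some i then (1 : ℝ) else 0).symm
      rw [Finset.sum_boole]
    rw [mbac_probW, ← sum_noiseProb p n, ← Finset.sum_sub_distrib, htail', hD, Finset.mul_sum,
      ← Finset.sum_add_distrib]
    refine Finset.sum_le_sum fun e _ => ?_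
    have h0 := noiseProb_nonneg p e
    by_cases hd : c.dec (x + 0 + e) = some i
    · have hd' : x + 0 + e ∉ {y | c.dec y ≠ some i} := fun h => h hd
      rw [if_neg hd', if_pos hd, mul_one, sub_zero]
      by_cases he : e ∈ T
      · simpa [he] using hu e he
      · simpa [he] using hu0
    · have hd' : x + 0 + e ∈ {y | c.dec y ≠ some i} := hd
      rw [if_pos hd', if_neg hd, mul_zero, sub_self, add_zero]
      split_ifs <;> linarith
  have h2 : ∀ i, 1 - (mbac p q).errorAt c ((mbac p q).noAdversary n) i ≤ tail + u * D i := by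
    intro i
    have hone : ∑ x, (c.enc i).1 x = 1 := (c.enc i).2.2
    have : ∑ x, (c.enc i).1 x * (1 - (mbac p q).probW x 0 {y | c.dec y ≠ some i}) ≤
        ∑ x, (c.enc i).1 x * (tail + u * D i) :=
      Finset.sum_le_sum fun x _ => mul_le_mul_of_nonneg_left (h1 i x) ((c.enc i).2.1 x)
    simp only [mul_sub, mul_one, Finset.sum_sub_distrib] at this
    rw [← Finset.sum_mul, hone, one_mul] at this
    rwa [errorAt_noAdversary, mbac_noState]
  have hDsum : ∑ i, D i ≤ 2 ^ n := by
    have : ∑ i : Fin M, (Finset.univ.filter fun y => c.dec y = some i).card ≤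
        Fintype.card (Fin n → ZMod 2) := by
      rw [← Finset.card_biUnion]
      · exact Finset.card_le_univ _
      · intro i _ j _ hij
        rw [Function.onFun, Finset.disjoint_filter]
        intro y _ hy hy'
        exact hij (Option.some_injective _ (hy.symm.trans hy'))
    have h' : Fintype.card (Fin n → ZMod 2) = 2 ^ n := by simp [ZMod.card]
    rw [h'] at this
    simp only [D]
    exact_mod_cast this
  have h3 : ∑ i, (1 - (mbac p q).errorAt c ((mbac p q).noAdversary n) i) ≤
      M * tail + u * 2 ^ n := by
    refine (Finset.sum_le_sum fun i _ => h2 i).trans ?_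
    rw [Finset.sum_add_distrib, ← Finset.mul_sum]
    simp only [Finset.sum_const, Finset.card_univ, Fintype.card_fin, nsmul_eq_mul]
    gcongr
  rw [Finset.sum_sub_distrib] at h3
  simp only [Finset.sum_const, Finset.card_univ, Fintype.card_fin, nsmul_eq_mul, mul_one] at h3
  have h4 : 1 - (mbac p q).avgError c ((mbac p q).noAdversary n) =
      (M - ∑ i, (mbac p q).errorAt c ((mbac p q).noAdversary n) i) / M := by
    rw [avgError]
    field_simp
  rw [h4, div_le_iff₀ hM']
  refine h3.trans (le_of_eq ?_)
  field_simp

end Mbac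

/-! ### Exponential rates and diagonal sequences -/

section Rates

theorem two_rpow_mul_two_rpow (n : ℕ) (a b : ℝ) :
    (2 : ℝ) ^ (n * a) * (2 : ℝ) ^ (n * b) = (2 : ℝ) ^ (n * (a + b)) := by
  rw [← Real.rpow_add two_pos, mul_add]

theorem two_rpow_natCast_mul_mono (n : ℕ) {a b : ℝ} (h : a ≤ b) :
    (2 : ℝ) ^ (n * a) ≤ (2 : ℝ) ^ (n * b) :=
  Real.rpow_le_rpow_of_exponent_le one_le_two (mul_le_mul_of_nonneg_left h (Nat.cast_nonneg n))

theorem tendsto_natCast_mul_two_rpow_neg {a : ℝ} (ha : 0 < a) :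
    Tendsto (fun n : ℕ => (n : ℝ) * (2 : ℝ) ^ (n * -a)) atTop (𝓝 0) := by
  have h : ∀ n : ℕ, (2 : ℝ) ^ (n * -a) = ((2 : ℝ) ^ (-a)) ^ n := fun n => by
    rw [← Real.rpow_natCast, ← Real.rpow_mul zero_le_two, mul_comm]
  simp only [h]
  exact tendsto_self_mul_const_pow_of_lt_one (by positivity)
    (Real.rpow_lt_one_of_one_lt_of_neg one_lt_two (neg_lt_zero.2 ha))

theorem tendsto_two_rpow_neg {a : ℝ} (ha : 0 < a) :
    Tendsto (fun n : ℕ => (2 : ℝ) ^ (n * -a)) atTop (𝓝 0) := by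
  refine squeeze_zero' (Eventually.of_forall fun n => by positivity) ?_
    (tendsto_natCast_mul_two_rpow_neg ha)
  filter_upwards [eventually_ge_atTop 1] with n hn
  exact le_mul_of_one_le_left (by positivity) (by exact_mod_cast hn)

theorem eventually_natCast_mul_le_two_rpow {a : ℝ} (ha : 0 < a) (B : ℝ) :
    ∀ᶠ n : ℕ in atTop, B * n ≤ (2 : ℝ) ^ (n * a) := by
  have h := ((tendsto_natCast_mul_two_rpow_neg ha).const_mul B).eventually
    (eventually_le_nhds (show B * 0 < 1 by norm_num))
  filter_upwards [h] with n hn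
  have h2 : (2 : ℝ) ^ (n * -a) * (2 : ℝ) ^ (n * a) = 1 := by
    rw [two_rpow_mul_two_rpow]; simp
  calc B * n = B * (n * (2 : ℝ) ^ (n * -a)) * (2 : ℝ) ^ (n * a) := by
        rw [mul_assoc, mul_assoc, h2, mul_one]
    _ ≤ 1 * (2 : ℝ) ^ (n * a) := by gcongr
    _ = _ := one_mul _

theorem two_rpow_le_numMessages (R : ℝ) (n : ℕ) : (2 : ℝ) ^ (n * R) ≤ numMessages R n :=
  Nat.le_ceil _

theorem numMessages_pos (R : ℝ) (n : ℕ) : 0 < numMessages R n :=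
  Nat.ceil_pos.2 (by positivity)

theorem numMessages_le {R : ℝ} (hR : 0 ≤ R) (n : ℕ) :
    (numMessages R n : ℝ) ≤ 2 * (2 : ℝ) ^ (n * R) := by
  have h1 := Nat.ceil_lt_add_one (a := (2 : ℝ) ^ (n * R)) (by positivity)
  have h2 : (1 : ℝ) ≤ (2 : ℝ) ^ (n * R) := Real.one_le_rpow one_le_two (by positivity)
  rw [numMessages]
  linarith

/-- If each tolerance is met eventually, then a vanishing sequence of tolerances is. -/
theorem exists_tendsto_zero_eventually {P : ℝ → ℕ → Prop}
    (h : ∀ ε > 0, ∀ᶠ n in atTop, P ε n) :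
    ∃ ε : ℕ → ℝ, Tendsto ε atTop (𝓝 0) ∧ ∀ᶠ n in atTop, P (ε n) n := by
  classical
  let Q : ℕ → ℕ → Prop := fun n m => P (1 / ((m : ℝ) + 1)) n
  have hQ : ∀ m, ∀ᶠ n in atTop, Q n m := fun m => h _ Nat.one_div_pos_of_nat
  let φ : ℕ → ℕ := fun n => Nat.findGreatest (Q n) n
  have hφ : Tendsto φ atTop atTop := by
    refine tendsto_atTop.2 fun m => ?_
    filter_upwards [hQ m, eventually_ge_atTop m] with n hn hmn
    exact Nat.le_findGreatest hmn hn
  refine ⟨fun n => 1 / ((φ n : ℝ) + 1), tendsto_one_div_add_atTop_nhds_zero_nat.comp hφ, ?_⟩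
  -- `Nat.findGreatest` defaults to `0`, so its value is known to satisfy `Q n` only once `Q n 0`
  -- holds.
  filter_upwards [hQ 0] with n hn
  exact Nat.findGreatest_spec (P := Q n) (Nat.zero_le n) hn

end Rates

/-! ### Choice of exponents and the capacities -/

section Capacity

open MyopicChannel

variable {p q : unitInterval}

/-- The converse: no rate above `1 - H(p)` is achievable even if the adversary is absent. -/
theorem le_of_isNoAdversaryAchievable {R : ℝ} (h : (mbac p q).IsNoAdversaryAchievable R) :
    R ≤ 1 - binEntropyBits p := by
  by_contra hlt
  push Not at hlt
  obtain ⟨_, c, hc⟩ := h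
  set H := binEntropyBits p with hH
  -- With half the excess rate as `δ`, `1 - (H - δ) = R - δ`, so the counting term decays like `2 ^
  -- (-n * δ)`.
  have hδ : 0 < (R - 1 + H) / 2 := by linarith
  obtain ⟨C, hC⟩ := exists_typical_noise p hδ
  set δ := (R - 1 + H) / 2 with hδdef
  have hlim : Tendsto (fun n : ℕ => C / n + (2 : ℝ) ^ (n * -δ)) atTop (𝓝 (0 + 0)) :=
    (tendsto_const_div_atTop_nhds_zero_nat C).add (tendsto_two_rpow_neg hδ)
  have hlim' := hc.const_sub 1
  have hle : (1 : ℝ) - 0 ≤ 0 + 0 := by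
    refine le_of_tendsto_of_tendsto hlim' hlim ?_
    filter_upwards [eventually_gt_atTop 0] with n hn
    obtain ⟨T, h1, -, h3⟩ := hC n hn
    have hMpos := numMessages_pos R n
    refine (one_sub_avgError_noAdversary_le p q hMpos (c n) T (by positivity) h3).trans
      (add_le_add h1 ?_)
    rw [div_le_iff₀ (Nat.cast_pos.2 hMpos)]
    calc (2 : ℝ) ^ n * (2 : ℝ) ^ (-(n * (H - δ)))
        = (2 : ℝ) ^ (n * (1 : ℝ)) * (2 : ℝ) ^ (n * -(H - δ)) := by
          rw [mul_one, Real.rpow_natCast, mul_neg]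
      _ = (2 : ℝ) ^ (n * -δ) * (2 : ℝ) ^ (n * R) := by
          rw [two_rpow_mul_two_rpow, two_rpow_mul_two_rpow]
          congr 2
          rw [hδdef]
          ring
      _ ≤ _ := by
          gcongr
          exact two_rpow_le_numMessages R n
  norm_num at hle

/-- Below `1 - H` the mean number of codewords in a ball is at most `2 ^ (-3 * n * δ)`. With `D + 1
≥ 1 / δ` its power is at most `2 ^ (-3 * n)`, which beats the `2 ^ n` centres; hence a constant `D`
suffices. -/
theorem code_ball_condition {n M a D : ℕ} {R H δ : ℝ} (hn : 1 ≤ n)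
    (hM : (M : ℝ) ≤ 2 * 2 ^ (n * R)) (ha : (a : ℝ) ≤ 2 ^ (n * (H + δ)))
    (hc : 5 * δ ≤ 1 - H - R) (hx : 32 ≤ (2 : ℝ) ^ (n * δ)) (hD : 1 ≤ δ * (D + 1)) :
    ((2 : ℝ) ^ n) * ((M : ℝ) * a / 2 ^ n) ^ (D + 1) < 1 / 2 := by
  have h2n : (2 : ℝ) ^ n = (2 : ℝ) ^ (n * (1 : ℝ)) := by rw [mul_one, Real.rpow_natCast]
  have hn' : (1 : ℝ) ≤ n := by exact_mod_cast hn
  have hδ : 0 < δ := by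
    by_contra hneg
    push Not at hneg
    have : δ * (D + 1) ≤ 0 := mul_nonpos_of_nonpos_of_nonneg hneg (by positivity)
    linarith
  have h1 : (M : ℝ) * a / 2 ^ n ≤ 2 ^ (n * (-(3 * δ))) := by
    rw [div_le_iff₀ (by positivity), h2n]
    calc (M : ℝ) * a ≤ (2 * 2 ^ (n * R)) * 2 ^ (n * (H + δ)) := by gcongr
      _ = 2 * 2 ^ (n * (R + (H + δ))) := by rw [mul_assoc, two_rpow_mul_two_rpow]
      _ ≤ 2 ^ (n * δ) * 2 ^ (n * (1 - 4 * δ)) := by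
          exact mul_le_mul (by linarith) (two_rpow_natCast_mul_mono n (by linarith))
            (by positivity) (by positivity)
      _ ≤ _ := by
          rw [two_rpow_mul_two_rpow, two_rpow_mul_two_rpow]
          exact two_rpow_natCast_mul_mono n (by linarith)
  have h3 : ((M : ℝ) * a / 2 ^ n) ^ (D + 1) ≤ 2 ^ (n * (-3 : ℝ)) := by
    calc _ ≤ ((2 : ℝ) ^ (n * (-(3 * δ)))) ^ (D + 1) := by gcongr
      _ = (2 : ℝ) ^ (n * (-(3 * (δ * (D + 1))))) := by
          rw [← Real.rpow_natCast, ← Real.rpow_mul zero_le_two]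
          congr 1
          push_cast
          ring
      _ ≤ _ := two_rpow_natCast_mul_mono n (by linarith)
  calc _ ≤ (2 : ℝ) ^ (n * (1 : ℝ)) * 2 ^ (n * (-3 : ℝ)) := by rw [h2n] at h3 ⊢; gcongr
    _ = (2 : ℝ) ^ (n * (-2 : ℝ)) := by
        rw [two_rpow_mul_two_rpow]
        norm_num
    _ ≤ (2 : ℝ) ^ (-2 : ℝ) := Real.rpow_le_rpow_of_exponent_le one_le_two (by linarith)
    _ < 1 / 2 := by
        rw [Real.rpow_neg zero_le_two]
        norm_num

/-- From `k ^ k / k! ≤ e ^ k ≤ 4 ^ k` and `μ ≤ k / 8`. -/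
theorem pow_div_factorial_le {k : ℕ} {μ : ℝ} (hμ0 : 0 ≤ μ) (hμ : 8 * μ ≤ k) :
    μ ^ k / k.factorial ≤ (1 / 2) ^ k := by
  have h1 : (k : ℝ) ^ k / k.factorial ≤ 4 ^ k := by
    refine (Real.pow_div_factorial_le_exp (k : ℝ) (Nat.cast_nonneg k) k).trans ?_
    rw [← mul_one (k : ℝ), Real.exp_nat_mul]
    gcongr
    linarith [Real.exp_one_lt_d9]
  calc μ ^ k / k.factorial ≤ ((k : ℝ) / 8) ^ k / k.factorial := by
        gcongr
        linarith
    _ = (1 / 8) ^ k * ((k : ℝ) ^ k / k.factorial) := by rw [div_pow, one_div, inv_pow]; ring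
    _ ≤ (1 / 8) ^ k * 4 ^ k := by gcongr
    _ = (1 / 2) ^ k := by rw [← mul_pow]; norm_num

/-- The mean `μ` has exponent at most `2 * R + H + H' - 2 + 2 * δ`, up to a factor `4`. The factor
`32` in `8 * μ` costs another `δ`, and `hc` then brings it below the exponent of `k`. With `k ≥ 2 *
n + 2`, `2 ^ (-k)` beats the `4 ^ n` pairs. -/
theorem code_matching_condition {n M a l k : ℕ} {R H H' δ : ℝ} (hδ : 0 < δ)
    (hM : (M : ℝ) ≤ 2 * 2 ^ (n * R)) (ha : (a : ℝ) ≤ 2 ^ (n * (H + δ)))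
    (hl : (l : ℝ) ≤ 2 ^ (n * (H' + δ))) (hc : 5 * δ ≤ 1 - H - R) (hg : 5 * δ ≤ R - 1 + H')
    (hk : (2 : ℝ) ^ (n * (R - 1 + H' - 2 * δ)) ≤ k)
    (hx : 32 ≤ (2 : ℝ) ^ (n * δ)) (hx' : 2 * n + 2 ≤ (2 : ℝ) ^ (n * δ)) :
    ((2 : ℝ) ^ n) ^ 2 * (((M : ℝ) ^ 2 * (l * a) / (2 ^ n) ^ 2) ^ k / k.factorial) < 1 / 2 := by
  have h2n : (2 : ℝ) ^ n = (2 : ℝ) ^ (n * (1 : ℝ)) := by rw [mul_one, Real.rpow_natCast]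
  have hkn : 2 * n + 2 ≤ k := by
    have : (2 : ℝ) ^ (n * δ) ≤ 2 ^ (n * (R - 1 + H' - 2 * δ)) :=
      two_rpow_natCast_mul_mono n (by linarith)
    exact_mod_cast hx'.trans (this.trans hk)
  have hμ : 8 * ((M : ℝ) ^ 2 * (l * a) / (2 ^ n) ^ 2) ≤ k := by
    refine le_trans ?_ hk
    rw [mul_div_assoc', div_le_iff₀ (by positivity), h2n]
    calc 8 * ((M : ℝ) ^ 2 * (l * a))
        ≤ 8 * ((2 * 2 ^ (n * R)) ^ 2 * (2 ^ (n * (H' + δ)) * 2 ^ (n * (H + δ)))) := by gcongr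
      _ = 32 * 2 ^ (n * (2 * R + H' + H + 2 * δ)) := by
          rw [mul_pow, sq ((2 : ℝ) ^ (n * R)), two_rpow_mul_two_rpow, two_rpow_mul_two_rpow,
            mul_assoc, two_rpow_mul_two_rpow, ← mul_assoc]
          congr 1
          · norm_num
          · congr 2
            ring
      _ ≤ 2 ^ (n * δ) * 2 ^ (n * (2 * R + H' + H + 2 * δ)) := by gcongr
      _ ≤ _ := by
          rw [sq, two_rpow_mul_two_rpow, two_rpow_mul_two_rpow, two_rpow_mul_two_rpow]
          exact two_rpow_natCast_mul_mono n (by linarith)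
  calc _ ≤ ((2 : ℝ) ^ n) ^ 2 * (1 / 2) ^ k := by
        gcongr
        exact pow_div_factorial_le (by positivity) hμ
    _ ≤ ((2 : ℝ) ^ n) ^ 2 * (1 / 2) ^ (2 * n + 2) := by
        gcongr ?_ * ?_
        exact pow_le_pow_of_le_one (by norm_num) (by norm_num) hkn
    _ = 1 / 4 := by
        rw [← pow_mul, pow_add, mul_comm n 2, ← mul_assoc, ← mul_pow]
        norm_num
    _ < 1 / 2 := by norm_num

open Classical in
theorem exists_vanishing_worstError {R : ℝ} (hR0 : 0 ≤ R) (hRq : 1 - binEntropyBits q < R)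
    (hRp : R < 1 - binEntropyBits p) :
    ∃ ε : ℕ → ℝ, Tendsto ε atTop (𝓝 0) ∧ ∀ᶠ n in atTop,
      ∃ c : AuthCode (ZMod 2) (ZMod 2) (numMessages R n) n,
        c.IsDeterministic ∧ (mbac p q).worstError c ≤ ε n := by
  set H := binEntropyBits p with hH
  set H' := binEntropyBits q with hH'
  obtain ⟨δ, hδ, hc, hg⟩ : ∃ δ : ℝ, 0 < δ ∧ 5 * δ ≤ 1 - H - R ∧ 5 * δ ≤ R - 1 + H' := by
    refine ⟨min (1 - H - R) (R - 1 + H') / 5, ?_, ?_, ?_⟩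
    · have : 0 < min (1 - H - R) (R - 1 + H') := lt_min (by linarith) (by linarith)
      positivity
    · linarith [min_le_left (1 - H - R) (R - 1 + H')]
    · linarith [min_le_right (1 - H - R) (R - 1 + H')]
  obtain ⟨Cp, hCp⟩ := exists_typical_noise p hδ
  obtain ⟨Cq, hCq⟩ := exists_typical_noise q hδ
  obtain ⟨D, hD⟩ : ∃ D : ℕ, 1 ≤ δ * ((D : ℝ) + 1) := by
    obtain ⟨D, hD⟩ := exists_nat_ge (1 / δ)
    refine ⟨D, ?_⟩
    rw [div_le_iff₀ hδ] at hD
    nlinarith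
  refine ⟨fun n => Cp / n + Cq / n + 4 * (1 + D) * (2 : ℝ) ^ (n * -δ), ?_, ?_⟩
  · have := ((tendsto_const_div_atTop_nhds_zero_nat Cp).add
      (tendsto_const_div_atTop_nhds_zero_nat Cq)).add
      ((tendsto_two_rpow_neg hδ).const_mul (4 * (1 + (D : ℝ))))
    simpa using this
  filter_upwards [eventually_ge_atTop 1, eventually_natCast_mul_le_two_rpow hδ 32] with n hn hx
  have hn' : (1 : ℝ) ≤ n := by exact_mod_cast hn
  obtain ⟨A, hA1, hA2, -⟩ := hCp n hn
  obtain ⟨L, hL1, hL2, hL3⟩ := hCq n hn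
  have hMle := numMessages_le hR0 n
  have hMpos := numMessages_pos R n
  have hMge := two_rpow_le_numMessages R n
  have hcard : (Fintype.card (Fin n → ZMod 2) : ℝ) = 2 ^ n := by simp [ZMod.card]
  -- About `2 ^ (n * (R - 1 + H'))` messages are compatible with an observation. The loss `2 * δ`
  -- exceeds the slack `δ` in `hL3`, leaving a net factor `2 ^ (-n * δ)`; `k` has the form of
  -- `numMessages`, so `numMessages_le` applies.
  set k : ℕ := ⌈(2 : ℝ) ^ (n * (R - 1 + H' - 2 * δ))⌉₊ with hkdef
  have hk : (2 : ℝ) ^ (n * (R - 1 + H' - 2 * δ)) ≤ k := Nat.le_ceil _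
  have hk2 : (k : ℝ) ≤ 2 * 2 ^ (n * (R - 1 + H' - 2 * δ)) :=
    numMessages_le (by linarith) n
  have hx1 : 32 ≤ (2 : ℝ) ^ (n * δ) := by linarith
  have hx2 : 2 * n + 2 ≤ (2 : ℝ) ^ (n * δ) := by linarith
  obtain ⟨f, hf1, hf2⟩ := exists_code (ι := Fin (numMessages R n)) D k L A
    (by rw [hcard, Fintype.card_fin]; exact code_ball_condition hn hMle hA2 hc hx1 hD)
    (by rw [hcard, Fintype.card_fin]
        exact code_matching_condition hδ hMle hA2 hL2 hc hg hk hx1 hx2)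
  refine ⟨_, AuthCode.isDeterministic_ofCodewords f (uniqueDecoder f A), ?_⟩
  have hK : ∀ z s, ((Finset.univ.filter fun i =>
      z - f i ∈ L ∧ ∃ j, j ≠ i ∧ f i + s - f j ∈ A).card : ℝ) ≤ 2 * k * (1 + D) := by
    intro z s
    exact_mod_cast card_confusable_le hf1 z s (hf2 z s)
  have hbound := worstError_uniqueDecoder_le p q f hMpos A L (by positivity) hL3 hK
  refine le_trans (by convert hbound using 3) (add_le_add (add_le_add hA1 hL1) ?_)
  rw [mul_div_assoc', div_le_iff₀ (Nat.cast_pos.2 hMpos)]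
  have h2n : (2 : ℝ) ^ n = (2 : ℝ) ^ (n * (1 : ℝ)) := by rw [mul_one, Real.rpow_natCast]
  calc (2 : ℝ) ^ n * (2 ^ (-(n * (H' - δ))) * (2 * k * (1 + D)))
      ≤ (2 : ℝ) ^ (n * (1 : ℝ)) * (2 ^ (n * -(H' - δ)) *
          (2 * (2 * 2 ^ (n * (R - 1 + H' - 2 * δ))) * (1 + D))) := by
        rw [h2n, mul_neg]
        gcongr
    _ = 4 * (1 + D) * ((2 : ℝ) ^ (n * (1 : ℝ)) * 2 ^ (n * -(H' - δ)) *
          2 ^ (n * (R - 1 + H' - 2 * δ))) := by ring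
    _ = 4 * (1 + D) * ((2 : ℝ) ^ (n * -δ) * 2 ^ (n * R)) := by
        rw [two_rpow_mul_two_rpow, two_rpow_mul_two_rpow, two_rpow_mul_two_rpow]
        congr 3
        ring
    _ ≤ 4 * (1 + D) * ((2 : ℝ) ^ (n * -δ) * numMessages R n) := by gcongr
    _ = _ := by ring

theorem isDetAuthAchievable_of_lt {R : ℝ} (hR0 : 0 ≤ R) (hRq : 1 - binEntropyBits q < R)
    (hRp : R < 1 - binEntropyBits p) : (mbac p q).IsDetAuthAchievable R := by
  obtain ⟨ε, hε, hev⟩ := exists_vanishing_worstError hR0 hRq hRp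
  have hall : ∀ n, ∃ c : AuthCode (ZMod 2) (ZMod 2) (numMessages R n) n, c.IsDeterministic ∧
      ((∃ c' : AuthCode (ZMod 2) (ZMod 2) (numMessages R n) n,
        c'.IsDeterministic ∧ (mbac p q).worstError c' ≤ ε n) → (mbac p q).worstError c ≤ ε n) := by
    intro n
    by_cases h : ∃ c' : AuthCode (ZMod 2) (ZMod 2) (numMessages R n) n,
        c'.IsDeterministic ∧ (mbac p q).worstError c' ≤ ε n
    · obtain ⟨c, hc, hc'⟩ := h
      exact ⟨c, hc, fun _ => hc'⟩
    -- An arbitrary code fills the finitely many lengths where the bound may fail.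
    · exact ⟨_, AuthCode.isDeterministic_ofCodewords (fun _ => 0) fun _ => none,
        fun h' => absurd h' h⟩
  choose c hdet hc using hall
  refine ⟨hR0, c, hdet, squeeze_zero' (Eventually.of_forall fun n => worstError_nonneg _ _) ?_ hε⟩
  filter_upwards [hev] with n hn using hc n hn

theorem binEntropyBits_lt (hpq : p < q) (hq : (q : ℝ) ≤ 1 / 2) :
    binEntropyBits p < binEntropyBits q := by
  have hlt : (p : ℝ) < q := hpq
  have h := Real.binEntropy_strictMonoOn (a := (p : ℝ)) (b := (q : ℝ))
    ⟨p.2.1, by linarith⟩ ⟨q.2.1, by linarith⟩ hlt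
  exact div_lt_div_of_pos_right h (Real.log_pos one_lt_two)

theorem binEntropyBits_le_one (r : ℝ) : binEntropyBits r ≤ 1 :=
  div_le_one_of_le₀ Real.binEntropy_le_log_two (Real.log_nonneg one_le_two)

/-- The construction needs `R > 1 - H(q)`; this costs nothing near `1 - H(p)`, as `H(p) < H(q)`.
Also `R ≥ 0`, because `H(q) ≤ 1`. -/
theorem exists_isDetAuthAchievable_gt (hpq : p < q) (hq : (q : ℝ) ≤ 1 / 2) {b : ℝ}
    (hb : b < 1 - binEntropyBits p) :
    ∃ R, b < R ∧ R < 1 - binEntropyBits p ∧ (mbac p q).IsDetAuthAchievable R := by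
  have h := binEntropyBits_lt hpq hq
  have h1 := binEntropyBits_le_one q
  obtain ⟨R, hR1, hR2⟩ := exists_between
    (max_lt hb (show 1 - binEntropyBits q < 1 - binEntropyBits p by linarith))
  have hb' := (le_max_left _ _).trans_lt hR1
  have hq' := (le_max_right _ _).trans_lt hR1
  exact ⟨R, hb', hR2, isDetAuthAchievable_of_lt (by linarith) hq' hR2⟩

/-- Handles all three capacities at once by sandwiching `P` between the strongest and the weakest
notion. -/
theorem isLUB_of_isDetAuthAchievable_imp (hpq : p < q) (hq : (q : ℝ) ≤ 1 / 2) {P : ℝ → Prop}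
    (h1 : ∀ R, (mbac p q).IsDetAuthAchievable R → P R)
    (h2 : ∀ R, P R → (mbac p q).IsNoAdversaryAchievable R) :
    IsLUB {R | P R} (1 - binEntropyBits p) := by
  refine ⟨fun R hR => le_of_isNoAdversaryAchievable (h2 R hR), fun b hb => ?_⟩
  by_contra hlt
  obtain ⟨R, hbR, _, hR⟩ := exists_isDetAuthAchievable_gt hpq hq (not_le.1 hlt)
  exact absurd (hb (h1 R hR)) (not_le.2 hbR)

/-- Diagonal choice over rates increasing to `1 - H(p)`; rounding the number of messages changes the
rate by at most `1 / n`. -/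
theorem exists_capacity_achieving_codes (hpq : p < q) (hq : (q : ℝ) ≤ 1 / 2) :
    ∃ (M : ℕ → ℕ) (c : ∀ n, AuthCode (ZMod 2) (ZMod 2) (M n) n),
      (∀ n, (c n).IsDeterministic) ∧
      Tendsto (fun n => Real.logb 2 (M n) / n) atTop (𝓝 (1 - binEntropyBits p)) ∧
      Tendsto (fun n => (mbac p q).worstError (c n)) atTop (𝓝 0) := by
  let P : ℝ → ℕ → Prop := fun ε n => ∃ (M : ℕ) (c : AuthCode (ZMod 2) (ZMod 2) M n),
    c.IsDeterministic ∧ |Real.logb 2 M / n - (1 - binEntropyBits p)| ≤ ε ∧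
      (mbac p q).worstError c ≤ ε
  have hP : ∀ ε > 0, ∀ᶠ n in atTop, P ε n := by
    intro ε hε
    obtain ⟨R, hR1, hR2, hR0, c, hdet, hc⟩ := exists_isDetAuthAchievable_gt hpq hq
      (show 1 - binEntropyBits p - ε < 1 - binEntropyBits p by linarith)
    filter_upwards [hc.eventually (eventually_le_nhds hε), eventually_gt_atTop 0,
      tendsto_one_div_atTop_nhds_zero_nat.eventually (eventually_le_nhds hε)] with n hn hn0 hn1
    refine ⟨numMessages R n, c n, hdet n, ?_, hn⟩
    have hn0' : (0 : ℝ) < n := Nat.cast_pos.2 hn0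
    have hMpos : (0 : ℝ) < numMessages R n := Nat.cast_pos.2 (numMessages_pos R n)
    have hlow : n * R ≤ Real.logb 2 (numMessages R n) :=
      (Real.le_logb_iff_rpow_le one_lt_two hMpos).2 (two_rpow_le_numMessages R n)
    have hupp : Real.logb 2 (numMessages R n) ≤ 1 + n * R := by
      rw [Real.logb_le_iff_le_rpow one_lt_two hMpos, Real.rpow_add two_pos, Real.rpow_one]
      exact numMessages_le hR0 n
    have hlow' : R ≤ Real.logb 2 (numMessages R n) / n := by
      rw [le_div_iff₀ hn0']; linarith
    have hupp' : Real.logb 2 (numMessages R n) / n ≤ 1 / n + R := by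
      rw [div_le_iff₀ hn0', add_mul, one_div_mul_cancel hn0'.ne']; linarith
    rw [abs_le]
    constructor <;> linarith
  obtain ⟨ε, hε, hev⟩ := exists_tendsto_zero_eventually hP
  have hall : ∀ n, ∃ (M : ℕ) (c : AuthCode (ZMod 2) (ZMod 2) M n), c.IsDeterministic ∧
      (P (ε n) n → |Real.logb 2 M / n - (1 - binEntropyBits p)| ≤ ε n ∧
        (mbac p q).worstError c ≤ ε n) := by
    intro n
    by_cases h : P (ε n) n
    · obtain ⟨M, c, hdet, hc⟩ := h
      exact ⟨M, c, hdet, fun _ => hc⟩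
    · exact ⟨1, _, AuthCode.isDeterministic_ofCodewords (fun _ => 0) fun _ => none,
        fun h' => absurd h' h⟩
  choose M c hdet hc using hall
  refine ⟨M, c, hdet, ?_, ?_⟩
  · rw [tendsto_iff_norm_sub_tendsto_zero]
    refine squeeze_zero' (Eventually.of_forall fun n => norm_nonneg _) ?_ hε
    filter_upwards [hev] with n hn using (hc n hn).1
  · refine squeeze_zero' (Eventually.of_forall fun n => worstError_nonneg _ _) ?_ hε
    filter_upwards [hev] with n hn using (hc n hn).2

end Capacity

theorem theorem5 (p q : unitInterval) (hpq : p < q) (hq : (q : ℝ) ≤ 1 / 2) :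
    (mbac p q).HasNoAdversaryCapacity (1 - binEntropyBits p) ∧
    (mbac p q).HasAuthCapacity (1 - binEntropyBits p) ∧
    (mbac p q).HasDetAuthCapacity (1 - binEntropyBits p) ∧
    ∃ (M : ℕ → ℕ) (c : ∀ n, AuthCode (ZMod 2) (ZMod 2) (M n) n),
      (∀ n, (c n).IsDeterministic) ∧
      Tendsto (fun n => Real.logb 2 (M n) / n) atTop (𝓝 (1 - binEntropyBits p)) ∧
      Tendsto (fun n => (mbac p q).worstError (c n)) atTop (𝓝 0) :=
  ⟨isLUB_of_isDetAuthAchievable_imp hpq hq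
      (fun _ h => h.isAuthAchievable.isNoAdversaryAchievable) fun _ h => h,
    isLUB_of_isDetAuthAchievable_imp hpq hq (fun _ h => h.isAuthAchievable)
      fun _ h => h.isNoAdversaryAchievable,
    isLUB_of_isDetAuthAchievable_imp hpq hq (fun _ h => h)
      fun _ h => h.isAuthAchievable.isNoAdversaryAchievable,
    exists_capacity_achieving_codes hpq hq⟩
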